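/- Let $k$ be an algebraically closed field of characteristic zero and $G$ a connected reductive group over $k$ with Lie algebra $\mathfrak g$. Put $\mathbb K=k((t))$, $\mathbb O=k[[t]]$, $\Omega_{\mathbb K}=\mathbb K\,dt$, $\Omega_{\mathbb O}=\mathbb O\,dt$ and $$\mathrm{Conn}_G(\mathbb K)=\{\nabla=d+A:\ A\in\mathfrak g\otimes_k\Omega_{\mathbb K}\},$$ on which $G(\mathbb K)$ acts by $\mathrm{Ad}(g)(d+A)=d+(\mathrm{Ad}(g)A-(dg)g^{-1})$. Write $\nabla'\sim\nabla$ if $\nabla'=\mathrm{Ad}(g)\nabla$ for some $g\in G(\mathbb K)$. Likewise, for a field $\mathbb F\supset k$, let $\mathrm{Conn}_G(\mathbb F)=\{d+A: A\in\mathfrak g\otimes_k\Omega_{\mathbb F/k}\}$, where $\Omega_{\mathbb F/k}$ is the space of Kähler differentials. (1) The gauge equivalence classes are open in $\mathrm{Conn}_G(\mathbb K)$ for the $t$-adic topology, in which the sets $\nabla+t^n\mathfrak g\otimes\Omega_{\mathbb O}$, $n\ge 0$, form a neighbourhood basis of $\nabla$. (2) For every $\nabla\in\mathrm{Conn}_G(\mathbb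 K)$ there is an integer $n\ge 0$ such that every $\nabla'\in\mathrm{Conn}_G(\mathbb K)$ with $\nabla'-\nabla\in t^n\mathfrak g\otimes\Omega_{\mathbb O}$ satisfies $\nabla'\sim\nabla$. (3) Let $X$ be a smooth connected projective curve over $k$ with function field $\mathbb F=k(X)$. For every closed point $x\in X$, the completed local ring of $X$ at $x$ is isomorphic to $k[[t]]$ as a $k$-algebra, so that the completion $\mathbb K_x$ of $\mathbb F$ at $x$ is identified with $k((t))$. Let $x_1,\dots,x_N\in X$ be distinct closed points, let $\mathbb K_i$ be the completion of $\mathbb F$ at $x_i$, identified with $k((t))$ by means of any such isomorphism, and let $\nabla_i\in\mathrm{Conn}_G(\mathbb K_i)$ for $i=1,\dots,N$. Then there exists $\nabla\in\mathrm{Conn}_G(\mathbb F)$ whose image in $\mathrm{Conn}_G(\mathbb K_i)$ is gauge equivalent to $\nabla_i$ for all $i=1,\dots,N$. -/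

import Mathlib

open scoped TensorProduct LaurentSeries PowerSeries
open AlgebraicGeometry CategoryTheory

universe u v w w'

/-! ### Affine algebraic groups through their coordinate Hopf algebras

Throughout `H` is the coordinate ring `𝒪(G)` of an affine group scheme `G` over a field `k`, so that
`G(R) = Hom_{k-alg}(H, R)`, with the convolution group structure. -/

section AlgebraicGroup

variable (k : Type u) [Field k] (H : Type v) [CommRing H] [HopfAlgebra k H]

/-- The group `G(R)` of `R`-points of `G = Spec H`; Mathlib provides the group structure. -/
abbrev GroupPoints (R : Type w) [CommRing R] [Algebra k R] : Type (max v w) :=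
  WithConv (H →ₐ[k] R)

/-- The closed point of `Spec H` defined by a rational point of `G`. -/
def GroupPoints.toSpec (g : GroupPoints k H k) : PrimeSpectrum H :=
  ⟨RingHom.ker g.ofConv, RingHom.ker_isPrime _⟩

/-- The Zariski topology on `G(k)`. -/
@[reducible] def zariskiTopology : TopologicalSpace (GroupPoints k H k) :=
  TopologicalSpace.induced (GroupPoints.toSpec k H) inferInstance

variable {k H} in
/-- Right translation `(ρ_g φ)(x) = φ (x g)` by `g ∈ G(k)` on the regular functions on `G`. -/
noncomputable def rightTranslation (g : GroupPoints k H k) : H →ₗ[k] H :=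
  (TensorProduct.rid k H).toLinearMap ∘ₗ
    LinearMap.lTensor H g.ofConv.toLinearMap ∘ₗ Coalgebra.comul

variable {k H} in
/-- `g ∈ G(k)` is unipotent if right translation by `g` is a locally unipotent operator
on the regular functions. -/
def IsUnipotentPoint (g : GroupPoints k H k) : Prop :=
  ∀ φ : H, ∃ n : ℕ, ((rightTranslation g - 1 : Module.End k H) ^ n) φ = 0

/-- `G = Spec H` is a connected reductive group over the (algebraically closed) field `k`: it is a
smooth connected affine algebraic group, and every normal Zariski-closed connected subgroup
of `G(k)` consisting of unipotent elements is trivial. -/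
structure IsConnectedReductive : Prop where
  smooth : Algebra.Smooth k H
  connected : ConnectedSpace (PrimeSpectrum H)
  trivial_unipotentRadical : ∀ U : Subgroup (GroupPoints k H k), U.Normal →
    @IsClosed _ (zariskiTopology k H) (U : Set (GroupPoints k H k)) →
    @IsConnected _ (zariskiTopology k H) (U : Set (GroupPoints k H k)) →
    (∀ g ∈ U, IsUnipotentPoint g) → U = ⊥

/-- The tangent space `T₁G` of `G` at `1`: the linear functionals `D` on `𝒪(G)` such that
`D (a b) = a(1) D b + b(1) D a`. -/
def tangentLie : Submodule k (H →ₗ[k] k) where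
  carrier := {D | ∀ a b : H,
    D (a * b) = Coalgebra.counit (R := k) a * D b + Coalgebra.counit (R := k) b * D a}
  add_mem' {D E} hD hE a b := by
    simp only [LinearMap.add_apply, hD a b, hE a b]
    ring
  zero_mem' a b := by simp
  smul_mem' c D hD a b := by
    simp only [LinearMap.smul_apply, hD a b, smul_eq_mul]
    ring

/-- The (vector space underlying the) Lie algebra `𝔤 = T₁G`. -/
def LieAlg : Type (max u v) := tangentLie k H

noncomputable instance : AddCommGroup (LieAlg k H) :=
  inferInstanceAs (AddCommGroup (tangentLie k H))

noncomputable instance : Module k (LieAlg k H) :=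
  inferInstanceAs (Module k (tangentLie k H))

/-- The inclusion of `𝔤` in the space of linear functionals on `𝒪(G)`. -/
noncomputable def LieAlg.incl : LieAlg k H →ₗ[k] (H →ₗ[k] k) := (tangentLie k H).subtype

theorem LieAlg.incl_injective : Function.Injective (LieAlg.incl k H) := Subtype.val_injective

end AlgebraicGroup

/-! ### Connections and gauge transformations

The datum `(R, M, d)`, with `d : R → M` a `k`-linear derivation into an `R`-module, stands for a ring
of functions with its module of differentials. A connection `d + A` on the trivial `G`-bundle is
recorded by its matrix `A ∈ 𝔤 ⊗ M`. -/

section Gauge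

variable {k : Type u} [Field k] {H : Type v} [CommRing H] [HopfAlgebra k H]
variable {R : Type w} [CommRing R] [Algebra k R]
variable {M : Type w'} [AddCommGroup M] [Module R M] [Module k M] [IsScalarTower k R M]

variable (k H M) in
/-- The space of connections `{d + A : A ∈ 𝔤 ⊗ M}`. -/
abbrev Conn : Type (max u v w') := LieAlg k H ⊗[k] M

/-- The (injective) inclusion `𝔤 ⊗ M → Hom_k(𝒪(G), M)`, `D ⊗ m ↦ (φ ↦ D(φ) m)`, which regards an
`M`-valued element of the Lie algebra as an `M`-valued tangent vector of `G` at `1`. -/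
noncomputable def Conn.toHom : Conn k H M →ₗ[k] (H →ₗ[k] M) :=
  dualTensorHom k H M ∘ₗ LinearMap.rTensor M (LieAlg.incl k H)

theorem Conn.toHom_injective : Function.Injective (Conn.toHom (k := k) (H := H) (M := M)) := by
  rw [injective_iff_map_eq_zero]
  intro A hA
  let b := Module.Free.chooseBasis k M
  obtain ⟨c, rfl⟩ :=
    (TensorProduct.equivFinsuppOfBasisRight (M := LieAlg k H) b).symm.surjective A
  suffices c = 0 by simp [this]
  ext i
  apply LieAlg.incl_injective k H
  ext φ
  have h2 := congrArg (fun v => b.repr (v φ) i) hA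
  by_cases hc : c i = 0
  · simp [hc]
  · simpa [Conn.toHom, TensorProduct.equivFinsuppOfBasisRight_symm_apply, Finsupp.sum,
      Finsupp.single_apply, hc] using h2

/-- Left translation of an `M`-valued tangent vector: `φ ↦ ∑ g(φ₁) v(φ₂)`. -/
noncomputable def leftMul (g : H →ₗ[k] R) (v : H →ₗ[k] M) : H →ₗ[k] M :=
  TensorProduct.lift ((Algebra.lsmul k k M).toLinearMap.compl₁₂ g v) ∘ₗ Coalgebra.comul

/-- Right translation of an `M`-valued tangent vector: `φ ↦ ∑ g(φ₂) v(φ₁)`. -/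
noncomputable def rightMul (v : H →ₗ[k] M) (g : H →ₗ[k] R) : H →ₗ[k] M :=
  TensorProduct.lift ((Algebra.lsmul k k M).toLinearMap.compl₁₂ g v).flip ∘ₗ Coalgebra.comul

/-- The inverse of `g ∈ G(R)`, that is, `φ ↦ g(S φ)` for the antipode `S`. -/
noncomputable def GroupPoints.inverse (g : GroupPoints k H R) : GroupPoints k H R :=
  WithConv.toConv (g.ofConv.comp (HopfAlgebra.antipodeAlgHom k H))

/-- `Ad(g) v = g v g⁻¹` for `g ∈ G(R)` and an `M`-valued tangent vector `v` at `1`. -/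
noncomputable def adjointAction (g : GroupPoints k H R) (v : H →ₗ[k] M) : H →ₗ[k] M :=
  rightMul (leftMul g.ofConv.toLinearMap v) g.inverse.ofConv.toLinearMap

/-- `(dg) g⁻¹`, an `M`-valued tangent vector of `G` at `1`; here `dg : φ ↦ d (φ(g))` is
an `M`-valued tangent vector at `g`, and `φ(g)` is `g φ` for `g : 𝒪(G) → R`. -/
noncomputable def dlog (d : Derivation k R M) (g : GroupPoints k H R) : H →ₗ[k] M :=
  rightMul (d.toLinearMap ∘ₗ g.ofConv.toLinearMap) g.inverse.ofConv.toLinearMap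

/-- `d + A' ∼ d + A`: there is `g ∈ G(R)` with `A' = Ad(g) A - (dg) g⁻¹`. -/
def GaugeEquiv (d : Derivation k R M) (A' A : Conn k H M) : Prop :=
  ∃ g : GroupPoints k H R, A'.toHom = adjointAction g A.toHom - dlog d g

end Gauge

/-! ### The formal punctured disk

For `𝕂 = k((t))` the one-dimensional `𝕂`-space `Ω_𝕂 = 𝕂 dt` is identified with `𝕂` through
`f dt ↔ f`; the differential becomes `f ↦ df/dt`, and `Ω_𝕆 = 𝕆 dt` becomes `k[[t]]`. -/

section Local

variable (k : Type u) [Field k]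

/-- `k((t))` as a `k`-algebra, with the coefficientwise module structure. This is equal, but not by
definition, to the structure that instance search would find otherwise. -/
noncomputable instance laurentAlgebra : Algebra k k⸨X⸩ := HahnSeries.instAlgebra

theorem laurent_coeff_single_one_mul_derivative (a : k⸨X⸩) (n : ℤ) :
    (HahnSeries.single (1 : ℤ) (1 : k) * LaurentSeries.derivative k a).coeff n =
      (n : k) * a.coeff n := by
  have h := HahnSeries.coeff_single_mul_add (r := (1 : k)) (x := LaurentSeries.derivative k a)
    (a := n - 1) (b := (1 : ℤ))
  rw [sub_add_cancel] at h
  rw [h]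
  simp

theorem laurent_derivative_leibniz (a b : k⸨X⸩) :
    LaurentSeries.derivative k (a * b) =
      a • LaurentSeries.derivative k b + b • LaurentSeries.derivative k a := by
  have key : ∀ c : k⸨X⸩,
      (HahnSeries.single (1 : ℤ) (1 : k) * LaurentSeries.derivative k c).support ⊆ c.support := by
    intro c n hn hc
    rw [HahnSeries.mem_support, laurent_coeff_single_one_mul_derivative] at hn
    exact hn (by rw [hc, mul_zero])
  have h1 : (HahnSeries.single (1 : ℤ) (1 : k)) ≠ 0 := by simp
  apply mul_left_cancel₀ h1
  rw [smul_eq_mul, smul_eq_mul, mul_add, mul_left_comm, mul_comm b, ← mul_assoc _ _ b]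
  ext n
  rw [laurent_coeff_single_one_mul_derivative, HahnSeries.coeff_add,
    HahnSeries.coeff_mul_right' b.isPWO_support (key b),
    HahnSeries.coeff_mul_left' a.isPWO_support (key a), HahnSeries.coeff_mul,
    ← Finset.sum_add_distrib, Finset.mul_sum]
  refine Finset.sum_congr rfl fun ij hij => ?_
  rw [Finset.mem_antidiagonal] at hij
  rw [laurent_coeff_single_one_mul_derivative, laurent_coeff_single_one_mul_derivative, ← hij.2.2]
  push_cast
  ring

/-- The derivation `d/dt` of `k((t))`, that is, `d : 𝕂 → Ω_𝕂 = 𝕂 dt`. -/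
noncomputable def laurentD : Derivation k k⸨X⸩ k⸨X⸩ :=
  Derivation.mk' (LaurentSeries.derivative k) (laurent_derivative_leibniz k)

/-- The map `Ω_𝕆 → Ω_𝕂`, `p dt ↦ t^n p dt`. -/
noncomputable def tPowMul (n : ℕ) : k⟦X⟧ →ₗ[k] k⸨X⸩ where
  toFun p := HahnSeries.single (n : ℤ) 1 * (p : k⸨X⸩)
  map_add' p q := by simp [mul_add]
  map_smul' c p := by simp

variable (H : Type v) [CommRing H] [HopfAlgebra k H]

/-- The subspace `t^n 𝔤 ⊗ Ω_𝕆` of `𝔤 ⊗ Ω_𝕂`. -/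
noncomputable def tLattice (n : ℕ) : Submodule k (Conn k H k⸨X⸩) :=
  LinearMap.range (LinearMap.lTensor (LieAlg k H) (tPowMul k n))

theorem tPowMul_add (m n : ℕ) : tPowMul k (m + n) =
    tPowMul k m ∘ₗ LinearMap.mulLeft k ((PowerSeries.X : k⟦X⟧) ^ n) := by
  ext1 p
  simp [tPowMul, ← mul_assoc, PowerSeries.coe_pow, HahnSeries.single_pow]

theorem tLattice_antitone : Antitone (tLattice k H) := by
  intro m n hmn
  obtain ⟨r, rfl⟩ := Nat.exists_eq_add_of_le hmn
  rw [tLattice, tLattice, tPowMul_add, LinearMap.lTensor_comp]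
  exact LinearMap.range_comp_le_range _ _

/-- The `t`-adic topology on `Conn_G(𝕂)`: the sets `∇ + t^n 𝔤 ⊗ Ω_𝕆` form a
neighbourhood basis of `∇`. -/
@[reducible] def tAdicTopology : TopologicalSpace (Conn k H k⸨X⸩) where
  IsOpen U := ∀ A ∈ U, ∃ n : ℕ, ∀ A' : Conn k H k⸨X⸩, A' - A ∈ tLattice k H n → A' ∈ U
  isOpen_univ A _ := ⟨0, fun _ _ => Set.mem_univ _⟩
  isOpen_inter U V hU hV A hA := by
    obtain ⟨m, hm⟩ := hU A hA.1
    obtain ⟨n, hn⟩ := hV A hA.2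
    exact ⟨max m n, fun A' h => ⟨hm A' (tLattice_antitone k H (le_max_left m n) h),
      hn A' (tLattice_antitone k H (le_max_right m n) h)⟩⟩
  isOpen_sUnion S hS A := by
    rintro ⟨U, hU, hA⟩
    obtain ⟨n, hn⟩ := hS U hU A hA
    exact ⟨n, fun A' h => ⟨U, hU, hn A' h⟩⟩

end Local

/-! ### Curves -/

section Curve

variable {k : Type u} [Field k] {X : Scheme.{u}} (f : X ⟶ Spec (CommRingCat.of k))

/-- The local ring of `X` at `x`, with the `k`-algebra structure given by `f`. -/
def LocalRingAt (_ : X ⟶ Spec (CommRingCat.of k)) (x : X) : Type u := X.presheaf.stalk x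

variable (x : X)

noncomputable instance : CommRing (LocalRingAt f x) :=
  inferInstanceAs (CommRing (X.presheaf.stalk x))

instance : IsLocalRing (LocalRingAt f x) :=
  inferInstanceAs (IsLocalRing (X.presheaf.stalk x))

noncomputable instance : Algebra k (LocalRingAt f x) :=
  ((Scheme.ΓSpecIso (CommRingCat.of k)).inv ≫ f.appTop ≫ X.presheaf.germ ⊤ x trivial).hom.toAlgebra

variable [IsIntegral X]

/-- The field `𝔽 = k(X)`, with the `k`-algebra structure given by `f`. -/
def RatFunctions (_ : X ⟶ Spec (CommRingCat.of k)) : Type u := X.functionField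

noncomputable instance : Field (RatFunctions f) :=
  inferInstanceAs (Field X.functionField)

noncomputable instance : Algebra k (RatFunctions f) :=
  inferInstanceAs (Algebra k (LocalRingAt f (genericPoint X)))

noncomputable instance : Algebra (LocalRingAt f x) (RatFunctions f) :=
  inferInstanceAs (Algebra (X.presheaf.stalk x) X.functionField)

/-- An identification of the completion `𝕂_x` of `𝔽 = k(X)` at the point `x` with `k((t))`: an
isomorphism of `k`-algebras of the completed local ring at `x` with `k[[t]]`, together with the
resulting embedding `𝔽 ↪ k((t))` (which is determined by the isomorphism, since `𝔽` is the field of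
fractions of the local ring). -/
structure FormalCoordinate where
  iso : AdicCompletion (IsLocalRing.maximalIdeal (LocalRingAt f x)) (LocalRingAt f x) ≃ₐ[k] k⟦X⟧
  expand : RatFunctions f →ₐ[k] k⸨X⸩
  expand_algebraMap : ∀ s : LocalRingAt f x,
    expand (algebraMap (LocalRingAt f x) (RatFunctions f) s) =
      (iso (algebraMap (LocalRingAt f x) _ s) : k⸨X⸩)

end Curve

section Restrict

variable {k : Type u} [Field k] {F : Type w} [Field F] [Algebra k F]

/-- The map `Ω_{F/k} → Ω_𝕂 = 𝕂 dt`, `a db ↦ φ(a) (dφ(b)/dt) dt`, induced by `φ : F → 𝕂`. -/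
noncomputable def pullbackDifferential (φ : F →ₐ[k] k⸨X⸩) : Ω[F⁄k] →ₗ[k] k⸨X⸩ :=
  letI : Module F k⸨X⸩ := Module.compHom _ φ.toRingHom
  haveI : IsScalarTower k F k⸨X⸩ := ⟨fun c a y => by
    change φ (c • a) * y = c • (φ a * y)
    rw [map_smul, smul_mul_assoc]⟩
  (Derivation.liftKaehlerDifferential
    (Derivation.mk' ((laurentD k).toLinearMap ∘ₗ φ.toLinearMap) fun a b => by
      change laurentD k (φ (a * b)) = φ a * laurentD k (φ b) + φ b * laurentD k (φ a)
      rw [map_mul, Derivation.leibniz, smul_eq_mul, smul_eq_mul])).restrictScalars k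

theorem pullbackDifferential_smul_D (φ : F →ₐ[k] k⸨X⸩) (a b : F) :
    pullbackDifferential φ (a • KaehlerDifferential.D k F b) = φ a * laurentD k (φ b) := by
  let _ : Module F k⸨X⸩ := Module.compHom _ φ.toRingHom
  have _ : IsScalarTower k F k⸨X⸩ := ⟨fun c a y => by
    change φ (c • a) * y = c • (φ a * y)
    rw [map_smul, smul_mul_assoc]⟩
  change (Derivation.liftKaehlerDifferential _) (a • KaehlerDifferential.D k F b) = _
  rw [map_smul, Derivation.liftKaehlerDifferential_comp_D]
  rfl

variable {H : Type v} [CommRing H] [HopfAlgebra k H]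

/-- The map `Conn_G(F) → Conn_G(𝕂)` induced by `φ : F → 𝕂`. -/
noncomputable def Conn.restrict (φ : F →ₐ[k] k⸨X⸩) :
    Conn k H Ω[F⁄k] →ₗ[k] Conn k H k⸨X⸩ :=
  LinearMap.lTensor (LieAlg k H) (pullbackDifferential φ)

end Restrict

/-! Assertion (2) is an implicit function theorem for the orbit map of `∇ = d + A`, proved by
Newton's method. Up to sign its linearisation is `x ↦ dx + [A, x]` on `𝔤 ⊗ 𝕂`. The essential input
is `exists_connection_eq`: a linear differential system over `k((t))` is solvable for every
right-hand side of large order `n`, by a solution of order at least `n - c` with `c` independent of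
`n`. For a scalar operator this holds because its leading term multiplies `t^m` by `P(m) t^(m+v)`
with a nonzero polynomial `P`, and in characteristic zero `P` has no large integer root. A system is
reduced to scalar operators by enlarging a subspace step by step with the derivatives of one vector
and integrating by parts (`EventuallySolvable.exists_lt`).

If `A'` differs from `A` by order `n`, solve `dx + [A, x] = A' - A` with `x` of order `n - c`. Since
`G` is smooth, `1 + x` agrees to order `2(n - c)` with a point `h` of `G`
(`exists_point_of_tangent`), and transforming `A'` by `h` improves the error to order `n + 1` once
`n` is large. The products of these `h` converge `t`-adically to a gauge transformation from `A'` to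
`A`. All computations take place in the convolution algebra `Hom_k(𝒪(G), R)`, which contains both
`G(R)` and `𝔤 ⊗ R` and where the gauge relation reads `A' g = g A - dg`, as for matrices. Assertion
(1) follows by applying (2) at every point of a class and using transitivity.

For (3), differentials of a smooth curve are locally generated by one element, so Nakayama's lemma
makes the maximal ideal of a closed point principal; the residue field is `k`, and expansion in
powers of a uniformizer identifies the completion with `k[[t]]`. By (2) it then suffices to
approximate all the `∇_i` by one global connection. Writing them as multiples of `ds` for a
nonconstant `s` turns this into weak approximation for functions. The absolute values at distinct
points are inequivalent because their unit balls are the local rings, and on a separated curve the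
local ring inside `k(X)` determines the point. -/

/-! ### The `t`-adic filtration of `k((t))` -/

section Filtration

variable (k : Type u) [Field k]

/-- The subspace `t^n k[[t]]` of `k((t))`, for `n ∈ ℤ`. -/
def tFil (n : ℤ) : Submodule k k⸨X⸩ where
  carrier := {f | ∀ i < n, f.coeff i = 0}
  add_mem' hf hg i hi := by simp [hf i hi, hg i hi]
  zero_mem' i _ := by simp
  smul_mem' c f hf i hi := by
    change c • f.coeff i = 0
    simp [hf i hi]

variable {k}

theorem mem_tFil {n : ℤ} {f : k⸨X⸩} : f ∈ tFil k n ↔ ∀ i < n, f.coeff i = 0 := Iff.rfl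

theorem mem_tFil_iff_le_orderTop {n : ℤ} {f : k⸨X⸩} :
    f ∈ tFil k n ↔ (n : WithTop ℤ) ≤ f.orderTop := by
  rw [HahnSeries.le_orderTop_iff_forall, mem_tFil]
  simp

theorem tFil_antitone {m n : ℤ} (h : m ≤ n) : tFil k n ≤ tFil k m :=
  fun _ hf i hi => hf i (hi.trans_le h)

theorem mul_mem_tFil {m n l : ℤ} {f g : k⸨X⸩} (hf : f ∈ tFil k m) (hg : g ∈ tFil k n)
    (h : l ≤ m + n) : f * g ∈ tFil k l := by
  refine tFil_antitone h ?_
  rw [mem_tFil_iff_le_orderTop] at *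
  push_cast
  exact (add_le_add hf hg).trans HahnSeries.orderTop_add_le_mul

theorem exists_mem_tFil (f : k⸨X⸩) : ∃ n : ℤ, f ∈ tFil k n := by
  refine ⟨f.order, fun i hi => HahnSeries.coeff_eq_zero_of_lt_order hi⟩

theorem exists_forall_mem_tFil {ι : Type*} [Finite ι] (f : ι → k⸨X⸩) :
    ∃ n : ℤ, ∀ i, f i ∈ tFil k n := by
  cases nonempty_fintype ι
  choose n hn using fun i => exists_mem_tFil (f i)
  refine ⟨-∑ i, |n i|, fun i => tFil_antitone ?_ (hn i)⟩
  have h1 : |n i| ≤ ∑ i, |n i| :=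
    Finset.single_le_sum (f := fun i => |n i|) (fun i _ => abs_nonneg _) (Finset.mem_univ i)
  have h2 := neg_abs_le (n i)
  omega

theorem eq_zero_of_forall_mem_tFil {f : k⸨X⸩} (c : ℤ) (h : ∀ n : ℕ, f ∈ tFil k (n + c)) :
    f = 0 := by
  ext i
  exact h (i - c + 1).toNat i (by omega)

theorem algebraMap_mem_tFil (c : k) : algebraMap k k⸨X⸩ c ∈ tFil k 0 := by
  intro i hi
  change (HahnSeries.C c).coeff i = 0
  rw [HahnSeries.C_apply, HahnSeries.coeff_single_of_ne hi.ne]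

theorem laurentD_coeff (f : k⸨X⸩) (n : ℤ) :
    (laurentD k f).coeff n = ((n + 1 : ℤ) : k) * f.coeff (n + 1) := by
  change (LaurentSeries.derivative k f).coeff n = _
  simp

theorem laurentD_mem_tFil {m n : ℤ} {f : k⸨X⸩} (hf : f ∈ tFil k n) (h : m ≤ n - 1) :
    laurentD k f ∈ tFil k m := by
  intro i hi
  rw [laurentD_coeff, hf _ (by omega), mul_zero]

theorem eq_algebraMap_of_laurentD_eq_zero [CharZero k] {f : k⸨X⸩} (hf : laurentD k f = 0) :
    f = algebraMap k k⸨X⸩ (f.coeff 0) := by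
  ext i
  change _ = (HahnSeries.C (f.coeff 0)).coeff i
  rw [HahnSeries.C_apply]
  by_cases hi : i = 0
  · rw [hi, HahnSeries.coeff_single_same]
  · rw [HahnSeries.coeff_single_of_ne hi]
    have := laurentD_coeff f (i - 1)
    rw [hf, sub_add_cancel, HahnSeries.coeff_zero] at this
    simpa [hi] using this.symm

theorem coe_mem_tFil (p : k⟦X⟧) : (p : k⸨X⸩) ∈ tFil k 0 := by
  intro i hi
  rw [PowerSeries.coeff_coe, if_pos hi]

theorem coe_mem_tFil_iff {n : ℕ} {p : k⟦X⟧} :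
    (p : k⸨X⸩) ∈ tFil k n ↔ (PowerSeries.X : k⟦X⟧) ^ n ∣ p := by
  rw [PowerSeries.X_pow_dvd_iff]
  constructor
  · intro h m hm
    simpa using h m (by exact_mod_cast hm)
  · intro h i hi
    rw [PowerSeries.coeff_coe]
    split_ifs with h0
    · rfl
    · exact h _ (by omega)

theorem exists_coe_eq {f : k⸨X⸩} (hf : f ∈ tFil k 0) : ∃ p : k⟦X⟧, (p : k⸨X⸩) = f := by
  refine ⟨PowerSeries.mk fun n => f.coeff n, ?_⟩
  ext i
  rw [PowerSeries.coeff_coe]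
  split_ifs with h0
  · exact (hf i h0).symm
  · rw [PowerSeries.coeff_mk, Int.natAbs_of_nonneg (by omega)]

theorem mem_range_tPowMul_iff {n : ℕ} {f : k⸨X⸩} :
    f ∈ LinearMap.range (tPowMul k n) ↔ f ∈ tFil k n := by
  constructor
  · rintro ⟨p, rfl⟩
    refine mul_mem_tFil (m := n) (n := 0) ?_ (coe_mem_tFil p) (by simp)
    intro i hi
    rw [HahnSeries.coeff_single_of_ne hi.ne]
  · intro hf
    refine ⟨PowerSeries.mk fun i => f.coeff (n + i), ?_⟩
    change HahnSeries.single (n : ℤ) (1 : k) * _ = f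
    ext i
    have h := HahnSeries.coeff_single_mul_add (r := (1 : k)) (b := (n : ℤ))
      (x := ((PowerSeries.mk fun i : ℕ => f.coeff (n + i) : k⟦X⟧) : k⸨X⸩)) (a := i - n)
    rw [sub_add_cancel] at h
    rw [h, one_mul, PowerSeries.coeff_coe]
    split_ifs with h0
    · exact (hf i (by omega)).symm
    · rw [PowerSeries.coeff_mk, Int.natAbs_of_nonneg (by omega), add_sub_cancel]

/-- Completeness of `k((t))`. -/
theorem exists_tFil_limit (m : ℤ) (u : ℕ → k⸨X⸩) (hu : ∀ s : ℕ, u (s + 1) - u s ∈ tFil k (m + s)) :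
    ∃ f : k⸨X⸩, ∀ s : ℕ, f - u s ∈ tFil k (m + s) := by
  have hst : ∀ s r : ℕ, u (s + r) - u s ∈ tFil k (m + s) := by
    intro s r
    induction r with
    | zero => simp
    | succ r ih =>
      have := add_mem (tFil_antitone (by push_cast; omega) (hu (s + r))) ih
      rwa [sub_add_sub_cancel] at this
  obtain ⟨c, hc⟩ := exists_mem_tFil (u 0)
  -- The `i`-th coefficient of `u s` no longer changes once `m + s > i`, so the limit takes it from
  -- stage `i + 1 - m`. For `i < m` the truncation `toNat` gives stage `0`, hence the bound below by
  -- `min c m`.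
  have hb : BddBelow (Function.support fun i : ℤ => (u (i + 1 - m).toNat).coeff i) := by
    refine ⟨min c m, fun i hi => ?_⟩
    by_contra hlt
    refine hi ?_
    have : (i + 1 - m).toNat = 0 := by omega
    simp only [this]
    exact hc i (by omega)
  refine ⟨HahnSeries.ofSuppBddBelow _ hb, fun s i hi => ?_⟩
  obtain ⟨r, hr⟩ := Nat.exists_eq_add_of_le (show (i + 1 - m).toNat ≤ s by omega)
  have := hst (i + 1 - m).toNat r i (by omega)
  rw [← hr, HahnSeries.coeff_sub] at this
  rw [HahnSeries.coeff_sub, HahnSeries.coeff_ofSuppBddBelow, ← neg_eq_zero, neg_sub, this]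

end Filtration

/-! ### Scalar differential operators on `k((t))` -/

section ScalarOperators

variable {k : Type u} [Field k]

theorem laurentD_pow_coeff (i : ℕ) (f : k⸨X⸩) (m : ℤ) :
    (((laurentD k).toLinearMap ^ i) f).coeff m =
      (descPochhammer k i).eval ((m + i : ℤ) : k) * f.coeff (m + i) := by
  induction i generalizing m with
  | zero => simp
  | succ i ih =>
    rw [pow_succ', Module.End.mul_apply]
    change (laurentD k _).coeff m = _
    rw [laurentD_coeff, ih, descPochhammer_succ_right]
    have e : m + 1 + (i : ℤ) = m + ((i + 1 : ℕ) : ℤ) := by push_cast; ring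
    rw [e]
    simp
    ring

theorem laurentD_pow_mem_tFil {m n : ℤ} (i : ℕ) {f : k⸨X⸩} (hf : f ∈ tFil k n) (h : m ≤ n - i) :
    ((laurentD k).toLinearMap ^ i) f ∈ tFil k m := by
  intro j hj
  rw [laurentD_pow_coeff, hf _ (by omega), mul_zero]

theorem coeff_mul_add_of_mem_tFil {m n : ℤ} {f g : k⸨X⸩} (hf : f ∈ tFil k m) (hg : g ∈ tFil k n) :
    (f * g).coeff (m + n) = f.coeff m * g.coeff n := by
  have h : f - HahnSeries.single m (f.coeff m) ∈ tFil k (m + 1) := by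
    intro i hi
    by_cases him : i = m
    · simp [him]
    · rw [HahnSeries.coeff_sub, HahnSeries.coeff_single_of_ne him, hf i (by omega), sub_zero]
  have h2 := mul_mem_tFil h hg le_rfl (m + n) (by omega)
  rw [sub_mul, HahnSeries.coeff_sub, sub_eq_zero] at h2
  rw [h2, add_comm, HahnSeries.coeff_single_mul_add]

/-- Successive approximation. -/
theorem exists_eq_of_approx (L : k⸨X⸩ →ₗ[k] k⸨X⸩) (v n₁ : ℤ)
    (h1 : ∀ m ≥ n₁, ∀ u ∈ tFil k m, L u ∈ tFil k (m + v))
    (h2 : ∀ m ≥ n₁, ∀ y ∈ tFil k (m + v), ∃ u ∈ tFil k m, y - L u ∈ tFil k (m + v + 1))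
    (m : ℤ) (hm : n₁ ≤ m) (y : k⸨X⸩) (hy : y ∈ tFil k (m + v)) :
    ∃ u ∈ tFil k m, L u = y := by
  -- The hypothesis is placed after the existential so that `choose` yields a function defined on
  -- all `x`; the value outside the hypothesis is irrelevant.
  have step : ∀ (s : ℕ) (x : k⸨X⸩), ∃ x', y - L x ∈ tFil k (m + v + s) →
      y - L x' ∈ tFil k (m + v + (s + 1 : ℕ)) ∧ x' - x ∈ tFil k (m + s) := by
    intro s x
    by_cases hx : y - L x ∈ tFil k (m + v + s)
    · obtain ⟨u, hu, hu'⟩ := h2 (m + s) (by omega) (y - L x) (by rwa [add_right_comm])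
      refine ⟨x + u, fun _ => ⟨?_, by simpa using hu⟩⟩
      rw [map_add, ← sub_sub]
      exact tFil_antitone (by push_cast; omega) hu'
    · exact ⟨0, fun h => absurd h hx⟩
  choose g hg using step
  let x : ℕ → k⸨X⸩ := fun s => Nat.rec 0 g s
  have hx : ∀ s : ℕ, y - L (x s) ∈ tFil k (m + v + s) := by
    intro s
    induction s with
    | zero => simpa [x] using hy
    | succ s ih => exact (hg s (x s) ih).1
  obtain ⟨u, hu⟩ := exists_tFil_limit m x fun s => (hg s (x s) (hx s)).2
  refine ⟨u, by simpa [x] using hu 0, ?_⟩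
  rw [← sub_eq_zero]
  refine eq_zero_of_forall_mem_tFil (m + v) fun s => ?_
  have := sub_mem (h1 (m + s) (by omega) _ (hu s))
    (tFil_antitone (show m + s + v ≤ m + v + s by omega) (hx s))
  rw [map_sub] at this
  refine tFil_antitone (m := s + (m + v)) (by omega) ?_ (n := m + s + v)
  convert this using 1
  abel

/-- The `i`-th shifted factor is monic of degree exactly `i`, so the largest `i` with `c i ≠ 0`
contributes a leading term that nothing can cancel. -/
theorem sum_C_mul_comp_descPochhammer_ne_zero (d : ℕ) (c b : ℕ → k)
    (hc : ∃ i ≤ d, c i ≠ 0) :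
    ∑ i ∈ Finset.range (d + 1), Polynomial.C (c i) *
      (descPochhammer k i).comp (Polynomial.X + Polynomial.C (b i)) ≠ 0 := by
  classical
  obtain ⟨i, hid, hi⟩ := hc
  let j := Nat.findGreatest (fun i => c i ≠ 0) d
  have hj : c j ≠ 0 := Nat.findGreatest_spec (P := fun i => c i ≠ 0) hid hi
  have hjd : j ≤ d := Nat.findGreatest_le d
  have hdeg : ∀ i, ((descPochhammer k i).comp
      (Polynomial.X + Polynomial.C (b i))).natDegree = i := by
    intro i
    rw [Polynomial.natDegree_comp, descPochhammer_natDegree, Polynomial.natDegree_X_add_C, mul_one]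
  intro h0
  have := congrArg (fun p => Polynomial.coeff p j) h0
  simp only [Polynomial.finsetSum_coeff, Polynomial.coeff_C_mul, Polynomial.coeff_zero] at this
  rw [Finset.sum_eq_single j] at this
  · have hm : ((descPochhammer k j).comp (Polynomial.X + Polynomial.C (b j))).Monic :=
      (monic_descPochhammer k j).comp_X_add_C _
    have hl := hm.coeff_natDegree
    rw [hdeg] at hl
    rw [hl, mul_one] at this
    exact hj this
  · intro i hi hij
    rcases lt_or_gt_of_ne hij with h | h
    · rw [Polynomial.coeff_eq_zero_of_natDegree_lt (by rw [hdeg]; exact h), mul_zero]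
    · have : c i = 0 := by
        by_contra hne
        exact absurd (Nat.le_findGreatest (P := fun i => c i ≠ 0)
          (by simpa [Nat.lt_succ_iff] using hi) hne) (by simpa [j] using h)
      rw [this, zero_mul]
  · intro h
    exact absurd (Finset.mem_range.2 (Nat.lt_succ_of_le hjd)) h

theorem exists_forall_eval_intCast_ne_zero [CharZero k] {p : Polynomial k} (hp : p ≠ 0) :
    ∃ n₁ : ℤ, ∀ m ≥ n₁, p.eval (m : k) ≠ 0 := by
  have hfin : {m : ℤ | p.eval (m : k) = 0}.Finite := by
    refine Set.Finite.preimage (f := fun m : ℤ => (m : k)) (s := {x | p.IsRoot x})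
      (Int.cast_injective.injOn) ?_
    exact Polynomial.finite_setOfPred_isRoot hp
  obtain ⟨b, hb⟩ := hfin.bddAbove
  exact ⟨b + 1, fun m hm h => by have := hb h; omega⟩

/-- A nonzero scalar differential operator `u ↦ ∑ ∂ⁱ(aᵢ u)` solves `L u = y`, with a bounded loss,
for all `y` of large order. -/
theorem exists_scalarOperator_eq [CharZero k] (d : ℕ) (a : ℕ → k⸨X⸩) (ha : a d ≠ 0) :
    ∃ c n₀ : ℤ, ∀ n ≥ n₀, ∀ y ∈ tFil k n, ∃ u ∈ tFil k (n - c),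
      ∑ i ∈ Finset.range (d + 1), ((laurentD k).toLinearMap ^ i) (a i * u) = y := by
  -- `v` is the minimum of `ord (a i) - i`, the amount by which the operator shifts orders. By
  -- maximality some `a i` has a nonzero coefficient at `v + i`, so the polynomial governing leading
  -- coefficients is nonzero.
  obtain ⟨v, hv, hmax⟩ : ∃ v : ℤ, (∀ i ≤ d, a i ∈ tFil k (v + i)) ∧
      ∀ z : ℤ, (∀ i ≤ d, a i ∈ tFil k (z + i)) → z ≤ v := by
    refine Int.exists_greatest_of_bdd ⟨(a d).order - d, fun z hz => ?_⟩ ?_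
    · by_contra hlt
      exact ha (HahnSeries.coeff_order_eq_zero.1 (hz d le_rfl _ (by omega)))
    · obtain ⟨n, hn⟩ := exists_forall_mem_tFil fun i : Fin (d + 1) => a i
      exact ⟨n - d, fun i hi => tFil_antitone (by omega) (hn ⟨i, Nat.lt_succ_of_le hi⟩)⟩
  have hne : ∃ i ≤ d, (a i).coeff (v + i) ≠ 0 := by
    by_contra! hall
    have := hmax (v + 1) fun i hi j hj => by
      by_cases hj' : j = v + i
      · rw [hj', hall i hi]
      · exact hv i hi j (by omega)
    omega
  obtain ⟨n₁, hn₁⟩ := exists_forall_eval_intCast_ne_zero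
    (sum_C_mul_comp_descPochhammer_ne_zero d (fun i => (a i).coeff (v + i))
      (fun i => ((v + i : ℤ) : k)) hne)
  let L : k⸨X⸩ →ₗ[k] k⸨X⸩ := ∑ i ∈ Finset.range (d + 1),
    ((laurentD k).toLinearMap ^ i) ∘ₗ LinearMap.mulLeft k (a i)
  have hL : ∀ u, L u = ∑ i ∈ Finset.range (d + 1), ((laurentD k).toLinearMap ^ i) (a i * u) := by
    intro u
    simp [L, LinearMap.sum_apply]
  have h1 : ∀ m ≥ n₁, ∀ u ∈ tFil k m, L u ∈ tFil k (m + v) := by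
    intro m _ u hu
    rw [hL]
    refine sum_mem fun i hi => laurentD_pow_mem_tFil i
      (mul_mem_tFil (hv i (Nat.lt_succ_iff.1 (Finset.mem_range.1 hi))) hu le_rfl) (by omega)
  suffices h2 : ∀ m ≥ n₁, ∀ y ∈ tFil k (m + v), ∃ u ∈ tFil k m, y - L u ∈ tFil k (m + v + 1) by
    refine ⟨v, n₁ + v, fun n hn y hy => ?_⟩
    obtain ⟨u, hu, huy⟩ := exists_eq_of_approx L v n₁ h1 h2 (n - v) (by omega) y (by simpa using hy)
    exact ⟨u, hu, by rw [← hL, huy]⟩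
  intro m hm y hy
  -- The operator sends `b t^m` to `P b t^(m+v)` plus higher terms, so dividing the leading
  -- coefficient of `y` by `P` gains one order.
  let P : k := ∑ i ∈ Finset.range (d + 1),
    (descPochhammer k i).eval ((m + v + i : ℤ) : k) * (a i).coeff (v + i)
  have hP : P ≠ 0 := by
    convert hn₁ m hm using 1
    simp only [P, Polynomial.eval_finsetSum, Polynomial.eval_mul, Polynomial.eval_C,
      Polynomial.eval_comp, Polynomial.eval_add, Polynomial.eval_X]
    refine Finset.sum_congr rfl fun i _ => ?_
    push_cast
    rw [mul_comm, add_assoc]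
  have hu : HahnSeries.single m (P⁻¹ * y.coeff (m + v)) ∈ tFil k m := by
    intro i hi
    rw [HahnSeries.coeff_single_of_ne hi.ne]
  refine ⟨_, hu, fun i hi => ?_⟩
  by_cases hi' : i = m + v
  · subst hi'
    rw [HahnSeries.coeff_sub, hL, HahnSeries.coeff_sum]
    rw [sub_eq_zero, Finset.sum_congr rfl fun i hi => by
      rw [laurentD_pow_coeff, show m + v + (i : ℤ) = v + i + m by ring, coeff_mul_add_of_mem_tFil
        (hv i (Nat.lt_succ_iff.1 (Finset.mem_range.1 hi))) hu, HahnSeries.coeff_single_same,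
        ← mul_assoc, show v + (i : ℤ) + m = m + v + i by ring], ← Finset.sum_mul]
    change _ = P * _
    rw [mul_inv_cancel_left₀ hP]
  · exact sub_mem hy (h1 m hm _ hu) i (by omega)

end ScalarOperators

/-! ### Linear differential systems over `k((t))` -/

section LinearSystems

variable {k : Type u} [Field k] {ι : Type w}

variable (k ι) in
/-- The vectors over `k((t))` with all coordinates in `t^n k[[t]]`. -/
def piFil (n : ℤ) : AddSubgroup (ι → k⸨X⸩) where
  carrier := {x | ∀ i, x i ∈ tFil k n}
  add_mem' hx hy i := add_mem (hx i) (hy i)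
  zero_mem' _ := zero_mem _
  neg_mem' hx i := neg_mem (hx i)

theorem piFil_antitone {m n : ℤ} (h : m ≤ n) : piFil k ι n ≤ piFil k ι m :=
  fun _ hx i => tFil_antitone h (hx i)

theorem exists_linearMap_mem_tFil [Finite ι] (ξ : (ι → k⸨X⸩) →ₗ[k⸨X⸩] k⸨X⸩) :
    ∃ c : ℤ, ∀ n, ∀ x ∈ piFil k ι n, ξ x ∈ tFil k (n - c) := by
  classical
  cases nonempty_fintype ι
  obtain ⟨c, hc⟩ := exists_forall_mem_tFil fun i => ξ fun j => if i = j then 1 else 0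
  refine ⟨-c, fun n x hx => ?_⟩
  rw [LinearMap.pi_apply_eq_sum_univ ξ x]
  refine sum_mem fun i _ => ?_
  rw [smul_eq_mul]
  exact mul_mem_tFil (n := c) (hx i) (hc i) (by omega)

theorem exists_smul_mem_piFil [Finite ι] (x : ι → k⸨X⸩) :
    ∃ c : ℤ, ∀ n, ∀ f ∈ tFil k n, f • x ∈ piFil k ι (n - c) := by
  obtain ⟨c, hc⟩ := exists_forall_mem_tFil x
  exact ⟨-c, fun n f hf i => mul_mem_tFil hf (hc i) (l := n - -c) (by omega)⟩

theorem exists_linearMap_mem_piFil [Finite ι] (p : (ι → k⸨X⸩) →ₗ[k⸨X⸩] (ι → k⸨X⸩)) :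
    ∃ c : ℤ, ∀ n, ∀ x ∈ piFil k ι n, p x ∈ piFil k ι (n - c) := by
  cases nonempty_fintype ι
  choose c hc using fun i => exists_linearMap_mem_tFil (LinearMap.proj i ∘ₗ p)
  refine ⟨∑ i, |c i|, fun n x hx i => tFil_antitone ?_ (hc i n x hx)⟩
  have h1 : |c i| ≤ ∑ i, |c i| :=
    Finset.single_le_sum (f := fun i => |c i|) (fun i _ => abs_nonneg _) (Finset.mem_univ i)
  have h2 := le_abs_self (c i)
  omega

/-- For `y` deep in the filtration `F`, the equation `∇ x = T y` has a solution `x ∈ W`, with a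
bounded loss. -/
def EventuallySolvable (D : (ι → k⸨X⸩) →+ (ι → k⸨X⸩)) (W : Submodule k⸨X⸩ (ι → k⸨X⸩)) {Y : Type*}
    (F : ℤ → Set Y) (T : Y → (ι → k⸨X⸩)) : Prop :=
  ∃ c n₀ : ℤ, ∀ n ≥ n₀, ∀ y ∈ F n, ∃ x ∈ W, x ∈ piFil k ι (n - c) ∧ D x = T y

namespace EventuallySolvable

variable {D : (ι → k⸨X⸩) →+ (ι → k⸨X⸩)} {W W' : Submodule k⸨X⸩ (ι → k⸨X⸩)}
  {Y Y' : Type*} {F : ℤ → Set Y} {F' : ℤ → Set Y'} {T T' : Y → (ι → k⸨X⸩)}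

theorem mono (h : EventuallySolvable D W F T) (hW : W ≤ W') : EventuallySolvable D W' F T := by
  obtain ⟨c, n₀, h⟩ := h
  refine ⟨c, n₀, fun n hn y hy => ?_⟩
  obtain ⟨x, hx, h2⟩ := h n hn y hy
  exact ⟨x, hW hx, h2⟩

theorem add (h : EventuallySolvable D W F T) (h' : EventuallySolvable D W F T') :
    EventuallySolvable D W F (fun y => T y + T' y) := by
  obtain ⟨c, n₀, h⟩ := h
  obtain ⟨c', n₀', h'⟩ := h'
  refine ⟨max c c', max n₀ n₀', fun n hn y hy => ?_⟩
  obtain ⟨x, hx, hxn, hxe⟩ := h n (by omega) y hy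
  obtain ⟨x', hx', hxn', hxe'⟩ := h' n (by omega) y hy
  exact ⟨x + x', add_mem hx hx', add_mem (piFil_antitone (by omega) hxn)
    (piFil_antitone (by omega) hxn'), by rw [map_add, hxe, hxe']⟩

theorem neg (h : EventuallySolvable D W F T) : EventuallySolvable D W F (fun y => - T y) := by
  obtain ⟨c, n₀, h⟩ := h
  refine ⟨c, n₀, fun n hn y hy => ?_⟩
  obtain ⟨x, hx, hxn, hxe⟩ := h n hn y hy
  exact ⟨-x, neg_mem hx, neg_mem hxn, by rw [map_neg, hxe]⟩

theorem sub (h : EventuallySolvable D W F T) (h' : EventuallySolvable D W F T') :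
    EventuallySolvable D W F (fun y => T y - T' y) := by
  simpa only [sub_eq_add_neg] using h.add h'.neg

theorem sum {α : Type*} (s : Finset α) {T : α → Y → (ι → k⸨X⸩)}
    (h : ∀ a ∈ s, EventuallySolvable D W F (T a)) :
    EventuallySolvable D W F (fun y => ∑ a ∈ s, T a y) := by
  classical
  induction s using Finset.induction_on with
  | empty => exact ⟨0, 0, fun n _ y _ => ⟨0, zero_mem _, zero_mem _, by simp⟩⟩
  | insert a s ha ih =>
    simp only [Finset.sum_insert ha]
    exact (h a (by simp)).add (ih fun b hb => h b (by simp [hb]))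

theorem comp (h : EventuallySolvable D W F T) (φ : Y' → Y)
    (hφ : ∃ c : ℤ, ∀ n, ∀ y ∈ F' n, φ y ∈ F (n - c)) :
    EventuallySolvable D W F' (fun y => T (φ y)) := by
  obtain ⟨c, n₀, h⟩ := h
  obtain ⟨c', hφ⟩ := hφ
  refine ⟨c + c', n₀ + c', fun n hn y hy => ?_⟩
  obtain ⟨x, hx, hxn, hxe⟩ := h (n - c') (by omega) _ (hφ n y hy)
  exact ⟨x, hx, by rwa [show n - (c + c') = n - c' - c by ring], hxe⟩

/-- Integration by parts: `f ∇ⁱv ≡ (-1)ⁱ f⁽ⁱ⁾ v` modulo the image of `∇`. -/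
theorem smul_iterate_sub [Finite ι]
    (hD : ∀ (f : k⸨X⸩) x, D (f • x) = laurentD k f • x + f • D x) (v : ι → k⸨X⸩) (d : ℕ)
    (hv : ∀ i < d, D^[i] v ∈ W) :
    EventuallySolvable D W (fun n => (tFil k n : Set k⸨X⸩))
      (fun f => f • D^[d] v - ((-1) ^ d * ((laurentD k).toLinearMap ^ d) f) • v) := by
  induction d with
  | zero => exact ⟨0, 0, fun n _ y _ => ⟨0, zero_mem _, zero_mem _, by simp⟩⟩
  | succ d ih =>
    have h1 : EventuallySolvable D W (fun n => (tFil k n : Set k⸨X⸩))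
      (fun f => D (f • D^[d] v)) := by
      obtain ⟨c, hc⟩ := exists_smul_mem_piFil (D^[d] v)
      exact ⟨c, 0, fun n _ f hf => ⟨f • D^[d] v, W.smul_mem _ (hv d (by simp)), hc n f hf, rfl⟩⟩
    have h2 := (ih fun i hi => hv i (by omega)).comp (F' := fun n => (tFil k n : Set k⸨X⸩))
      (laurentD k) ⟨1, fun n f hf => laurentD_mem_tFil hf le_rfl⟩
    convert h1.sub h2 using 2 with f
    rw [hD, Function.iterate_succ_apply', pow_succ (laurentD k).toLinearMap, pow_succ (-1 : k⸨X⸩)]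
    simp only [Module.End.mul_apply]
    change _ - (_ * ((laurentD k).toLinearMap ^ d) (laurentD k f)) • v = _
    rw [mul_neg_one, neg_mul, neg_smul]
    abel

end EventuallySolvable

/-- Adjoin to `W` all derivatives of a vector `v` outside it. The last one satisfies a relation `D^d
v = w₀ + ∑ ξᵢ D^i v` with `w₀ ∈ W`. Multiplying by `u` and integrating by parts shows that `L(u) v`
lies in the image of `D`, for a scalar operator `L` with leading coefficient `±1`. As `L` is
surjective in high order, every `f v` with `f` of large order is solved, and then so is every `f D^i
v`. -/
theorem EventuallySolvable.exists_lt [CharZero k] [Finite ι] {D : (ι → k⸨X⸩) →+ (ι → k⸨X⸩)}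
    (hD : ∀ (f : k⸨X⸩) x, D (f • x) = laurentD k f • x + f • D x)
    {W : Submodule k⸨X⸩ (ι → k⸨X⸩)}
    (hW : EventuallySolvable D W (fun n => {y | y ∈ W ∧ y ∈ piFil k ι n}) id) (hne : W ≠ ⊤) :
    ∃ W' > W, EventuallySolvable D W' (fun n => {y | y ∈ W' ∧ y ∈ piFil k ι n}) id := by
  classical
  obtain ⟨v, hv⟩ : ∃ v, v ∉ W := by
    by_contra! h
    exact hne (eq_top_iff.2 fun v _ => h v)
  let S : ℕ →o Submodule k⸨X⸩ (ι → k⸨X⸩) :=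
    ⟨fun j => W ⊔ Submodule.span _ ((fun i => D^[i] v) '' Set.Iio j), fun i j hij =>
      sup_le_sup_left (Submodule.span_mono (Set.image_mono fun a ha => lt_of_lt_of_le ha hij)) _⟩
  obtain ⟨d, hd⟩ := monotone_stabilizes_iff_noetherian.2 (inferInstance :
    IsNoetherian k⸨X⸩ (ι → k⸨X⸩)) S
  have hmem : ∀ i j, i < j → D^[i] v ∈ S j := fun i j hij =>
    (le_sup_right : _ ≤ S j) (Submodule.subset_span ⟨i, hij, rfl⟩)
  set W' := S d
  have hWW' : W ≤ W' := le_sup_left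
  have hmem' : ∀ i, D^[i] v ∈ W' := by
    intro i
    rcases lt_or_ge i d with h | h
    · exact hmem i d h
    · rw [hd (i + 1) (by omega)]
      exact hmem i _ (by omega)
  have hdecomp : ∀ y ∈ W', ∃ z : W × (Fin d → k⸨X⸩), (z.1 : ι → k⸨X⸩) +
      ∑ i, z.2 i • D^[(i : ℕ)] v = y := by
    intro y hy
    obtain ⟨w, hw, z, hz, rfl⟩ := Submodule.mem_sup.1 hy
    have himg : (fun i => D^[i] v) '' Set.Iio d = Set.range fun i : Fin d => D^[(i : ℕ)] v := by
      ext x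
      constructor
      · rintro ⟨i, hi, rfl⟩
        exact ⟨⟨i, hi⟩, rfl⟩
      · rintro ⟨i, rfl⟩
        exact ⟨i, i.2, rfl⟩
    rw [himg, Submodule.mem_span_range_iff_exists_fun] at hz
    obtain ⟨c, rfl⟩ := hz
    exact ⟨(⟨w, hw⟩, c), rfl⟩
  let T : (W × (Fin d → k⸨X⸩)) →ₗ[k⸨X⸩] W' :=
    { toFun := fun z => ⟨(z.1 : ι → k⸨X⸩) + ∑ i, z.2 i • D^[(i : ℕ)] v,
        add_mem (hWW' z.1.2) (sum_mem fun i _ => W'.smul_mem _ (hmem' i))⟩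
      map_add' := fun z z' => by
        ext1
        simp only [Prod.fst_add, Prod.snd_add, Submodule.coe_add, Pi.add_apply, add_smul,
          Finset.sum_add_distrib]
        abel
      map_smul' := fun c z => by
        ext1
        simp [Finset.smul_sum, smul_smul] }
  have hT : LinearMap.range T = ⊤ := LinearMap.range_eq_top.2 fun y => by
    obtain ⟨z, hz⟩ := hdecomp y y.2
    exact ⟨z, Subtype.ext hz⟩
  obtain ⟨σ, hσ⟩ := LinearMap.exists_rightInverse_of_surjective T hT
  -- Extending the section from `W'` to the whole space makes the components below linear on
  -- `k((t))^ι`, where linear maps lose only a bounded order.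
  obtain ⟨τ, hτ⟩ := LinearMap.exists_extend σ
  have hτT : ∀ y ∈ W', ((τ y).1 : ι → k⸨X⸩) + ∑ i, (τ y).2 i • D^[(i : ℕ)] v = y := by
    intro y hy
    have h1 := LinearMap.congr_fun hσ ⟨y, hy⟩
    have h2 := LinearMap.congr_fun hτ ⟨y, hy⟩
    have h3 := congrArg Subtype.val h1
    simp only [LinearMap.comp_apply, Submodule.subtype_apply] at h2 h3
    rw [← h2] at h3
    exact h3
  let p : (ι → k⸨X⸩) →ₗ[k⸨X⸩] (ι → k⸨X⸩) := W.subtype ∘ₗ LinearMap.fst _ _ _ ∘ₗ τ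
  let ξ : Fin d → (ι → k⸨X⸩) →ₗ[k⸨X⸩] k⸨X⸩ := fun i =>
    LinearMap.proj i ∘ₗ LinearMap.snd _ _ _ ∘ₗ τ
  have hpξ : ∀ y ∈ W', p y + ∑ i, ξ i y • D^[(i : ℕ)] v = y := hτT
  have hpW : ∀ y, p y ∈ W := fun y => (τ y).1.2
  have hparts : ∀ i, EventuallySolvable D W' (fun n => (tFil k n : Set k⸨X⸩))
      (fun f => f • D^[i] v - ((-1) ^ i * ((laurentD k).toLinearMap ^ i) f) • v) :=
    fun i => EventuallySolvable.smul_iterate_sub hD v i fun j _ => hmem' j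
  -- the scalar operator coming from the linear relation satisfied by the last derivative
  let w₀ := p (D^[d] v)
  let a : ℕ → k⸨X⸩ := fun i => if h : i < d then - (-1) ^ i * ξ ⟨i, h⟩ (D^[d] v) else (-1) ^ d
  have had : a d ≠ 0 := by simp [a]
  obtain ⟨c, n₀, hsolve⟩ := exists_scalarOperator_eq d a had
  let L : k⸨X⸩ → k⸨X⸩ := fun u =>
    ∑ i ∈ Finset.range (d + 1), ((laurentD k).toLinearMap ^ i) (a i * u)
  have hsign : ∀ (i : ℕ) (f : k⸨X⸩), ((laurentD k).toLinearMap ^ i) ((-1) ^ i * f) =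
      (-1) ^ i * ((laurentD k).toLinearMap ^ i) f := by
    intro i f
    rcases neg_one_pow_eq_or k⸨X⸩ i with h | h <;> simp [h]
  have hLv : EventuallySolvable D W' (fun n => (tFil k n : Set k⸨X⸩)) (fun u => L u • v) := by
    have h1 := (hparts d).neg
    have h2 : EventuallySolvable D W' (fun n => (tFil k n : Set k⸨X⸩)) (fun u => u • w₀) := by
      obtain ⟨c, hc⟩ := exists_smul_mem_piFil w₀
      exact (hW.mono hWW').comp (fun u => u • w₀)
        ⟨c, fun n f hf => ⟨W.smul_mem _ (hpW _), hc n f hf⟩⟩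
    have h3 := EventuallySolvable.sum (D := D) (W := W') (F := fun n => (tFil k n : Set k⸨X⸩))
      Finset.univ fun (i : Fin d) _ =>
        (hparts i).comp (F' := fun n => (tFil k n : Set k⸨X⸩)) (fun u => ξ i (D^[d] v) * u) (by
          obtain ⟨c, hc⟩ := exists_mem_tFil (ξ i (D^[d] v))
          exact ⟨-c, fun n f hf => mul_mem_tFil hc hf (by omega)⟩)
    -- The terms with derivatives of `v` and the term `u w₀` cancel by the relation for `D^d v`;
    -- what remains is `L u • v`.
    convert (h1.add h3).add h2 using 2 with u
    have hrel := hpξ _ (hmem' d)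
    have hLu : L u = (-1) ^ d * ((laurentD k).toLinearMap ^ d) u - ∑ i : Fin d,
        (-1) ^ (i : ℕ) * ((laurentD k).toLinearMap ^ (i : ℕ)) (ξ i (D^[d] v) * u) := by
      simp only [L]
      rw [Finset.sum_range_succ, Finset.sum_range, add_comm, sub_eq_add_neg,
        ← Finset.sum_neg_distrib]
      congr 1
      · simp [a, hsign]
      · refine Finset.sum_congr rfl fun i _ => ?_
        simp only [a, i.2, dif_pos, Fin.eta]
        rw [neg_mul, neg_mul, mul_assoc, map_neg, hsign]
    rw [hLu]
    simp only [Finset.sum_sub_distrib, sub_smul, Finset.sum_smul]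
    have : u • D^[d] v = u • w₀ + ∑ i : Fin d, (ξ i (D^[d] v) * u) • D^[(i : ℕ)] v := by
      conv_lhs => rw [← hrel]
      rw [smul_add, Finset.smul_sum]
      congr 1
      exact Finset.sum_congr rfl fun i _ => by rw [smul_smul, mul_comm]
    rw [this]
    abel
  have hfv : EventuallySolvable D W' (fun n => (tFil k n : Set k⸨X⸩)) (fun f => f • v) := by
    obtain ⟨c', n₀', h'⟩ := hLv
    refine ⟨c + c', max n₀ (n₀' + c), fun n hn f hf => ?_⟩
    obtain ⟨u, hu, hLu⟩ := hsolve n (by omega) f hf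
    obtain ⟨x, hx, hxn, hxe⟩ := h' (n - c) (by omega) u hu
    refine ⟨x, hx, by rwa [← sub_sub], ?_⟩
    rw [hxe]
    simp only [L, hLu]
  have hfe : ∀ i, EventuallySolvable D W' (fun n => (tFil k n : Set k⸨X⸩))
      (fun f => f • D^[i] v) := by
    intro i
    have h1 := hfv.comp (F' := fun n => (tFil k n : Set k⸨X⸩))
      (fun f => (-1) ^ i * ((laurentD k).toLinearMap ^ i) f)
      ⟨i, fun n f hf => by
        have := laurentD_pow_mem_tFil (m := n - i) i hf le_rfl
        rcases neg_one_pow_eq_or k⸨X⸩ i with h | h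
        · simpa [h] using this
        · simpa [h] using this⟩
    convert (hparts i).add h1 using 2 with f
    abel
  refine ⟨W', lt_of_le_of_ne hWW' fun h => hv (h ▸ hmem' 0), ?_⟩
  have h1 := EventuallySolvable.sum (D := D) (W := W')
    (F := fun n => {y | y ∈ W' ∧ y ∈ piFil k ι n})
    Finset.univ fun (i : Fin d) _ => (hfe i).comp (fun y => ξ i y) (by
      obtain ⟨c, hc⟩ := exists_linearMap_mem_tFil (ξ i)
      exact ⟨c, fun n y hy => hc n y hy.2⟩)
  have h2 := (hW.mono hWW').comp (F' := fun n => {y | y ∈ W' ∧ y ∈ piFil k ι n}) p (by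
    obtain ⟨c, hc⟩ := exists_linearMap_mem_piFil p
    exact ⟨c, fun n y hy => ⟨hpW y, hc n y hy.2⟩⟩)
  obtain ⟨c, n₀, h⟩ := h2.add h1
  refine ⟨c, n₀, fun n hn y hy => ?_⟩
  obtain ⟨x, hx, hxn, hxe⟩ := h n hn y hy
  exact ⟨x, hx, hxn, hxe.trans (hpξ y hy.1)⟩

/-- A differential system `∇ x = y` over `k((t))` is solvable, with a bounded loss, for all `y` of
large order. -/
theorem exists_connection_eq [CharZero k] [Finite ι] (D : (ι → k⸨X⸩) →+ (ι → k⸨X⸩))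
    (hD : ∀ (f : k⸨X⸩) x, D (f • x) = laurentD k f • x + f • D x) :
    ∃ c n₀ : ℤ, ∀ n ≥ n₀, ∀ y ∈ piFil k ι n, ∃ x ∈ piFil k ι (n - c), D x = y := by
  let P : Submodule k⸨X⸩ (ι → k⸨X⸩) → Prop := fun W =>
    EventuallySolvable D W (fun n => {y | y ∈ W ∧ y ∈ piFil k ι n}) id
  have h0 : P ⊥ := ⟨0, 0, fun n _ y hy => ⟨0, zero_mem _, zero_mem _, by
    simp [(Submodule.mem_bot _).1 hy.1]⟩⟩
  obtain ⟨W, hW, hmax⟩ := WellFounded.has_min (wellFounded_gt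
    (α := Submodule k⸨X⸩ (ι → k⸨X⸩))) {W | P W} ⟨⊥, h0⟩
  have hWtop : W = ⊤ := by
    by_contra hne
    obtain ⟨W', hlt, hW'⟩ := EventuallySolvable.exists_lt hD hW hne
    exact hmax W' hW' hlt
  obtain ⟨c, n₀, h⟩ := hW
  refine ⟨c, n₀, fun n hn y hy => ?_⟩
  obtain ⟨x, -, hx, hxe⟩ := h n hn y ⟨hWtop ▸ trivial, hy⟩
  exact ⟨x, hx, hxe⟩

end LinearSystems

/-! ### Gauge transformations in the convolution algebra -/

section Convolution

open WithConv Coalgebra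

variable {k : Type u} [Field k] {H : Type v} [CommRing H] [HopfAlgebra k H]
variable {R : Type w} [CommRing R] [Algebra k R]

/-- A point of `G` as an element of the convolution algebra. -/
def GroupPoints.toLin (g : GroupPoints k H R) : WithConv (H →ₗ[k] R) :=
  toConv g.ofConv.toLinearMap

theorem GroupPoints.toLin_apply (g : GroupPoints k H R) (a : H) : g.toLin a = g.ofConv a := rfl

theorem GroupPoints.toLin_mul (g h : GroupPoints k H R) : (g * h).toLin = g.toLin * h.toLin := rfl

theorem GroupPoints.toLin_one : (1 : GroupPoints k H R).toLin = 1 := rfl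

theorem GroupPoints.toLin_injective :
    Function.Injective (GroupPoints.toLin (k := k) (H := H) (R := R)) :=
  toConv_injective.comp (AlgHom.toLinearMap_injective.comp ofConv_injective)

theorem GroupPoints.toLin_mul_inverse (g : GroupPoints k H R) : g.toLin * g.inverse.toLin = 1 := by
  have h := LinearMap.algHom_comp_convMul_distrib g.ofConv (toConv LinearMap.id)
    (toConv (HopfAlgebra.antipode k (A := H)))
  rw [LinearMap.id_mul_antipode] at h
  refine Eq.trans (congrArg toConv h.symm) ?_
  ext a
  exact g.ofConv.commutes _

theorem GroupPoints.toLin_inverse_mul (g : GroupPoints k H R) : g.inverse.toLin * g.toLin = 1 := by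
  have h := LinearMap.algHom_comp_convMul_distrib g.ofConv
    (toConv (HopfAlgebra.antipode k (A := H))) (toConv LinearMap.id)
  rw [LinearMap.antipode_mul_id] at h
  refine Eq.trans (congrArg toConv h.symm) ?_
  ext a
  exact g.ofConv.commutes _

theorem GroupPoints.mul_inverse (g : GroupPoints k H R) : g * g.inverse = 1 :=
  toLin_injective g.toLin_mul_inverse

/-- A derivation of `R` acts on the convolution algebra of `R`-valued functionals. -/
def convDeriv (d : Derivation k R R) (v : WithConv (H →ₗ[k] R)) : WithConv (H →ₗ[k] R) :=
  toConv (d.toLinearMap ∘ₗ v.ofConv)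

theorem convDeriv_apply (d : Derivation k R R) (v : WithConv (H →ₗ[k] R)) (a : H) :
    convDeriv d v a = d (v a) := rfl

theorem convDeriv_add (d : Derivation k R R) (v w : WithConv (H →ₗ[k] R)) :
    convDeriv d (v + w) = convDeriv d v + convDeriv d w := by
  ext a
  exact map_add d _ _

theorem convDeriv_one (d : Derivation k R R) : convDeriv (H := H) d 1 = 0 := by
  ext a
  exact d.map_algebraMap _

theorem convDeriv_mul (d : Derivation k R R) (v w : WithConv (H →ₗ[k] R)) :
    convDeriv d (v * w) = convDeriv d v * w + v * convDeriv d w := by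
  ext a
  change convDeriv d (v * w) a = (convDeriv d v * w) a + (v * convDeriv d w) a
  rw [convDeriv_apply, (ℛ k a).convMul_apply, (ℛ k a).convMul_apply, (ℛ k a).convMul_apply, map_sum,
    ← Finset.sum_add_distrib]
  refine Finset.sum_congr rfl fun i _ => ?_
  rw [Derivation.leibniz, convDeriv_apply, convDeriv_apply, smul_eq_mul, smul_eq_mul]
  ring

theorem leftMul_eq (g v : H →ₗ[k] R) : leftMul g v = (toConv g * toConv v).ofConv := by
  have : TensorProduct.lift ((Algebra.lsmul k k R).toLinearMap.compl₁₂ g v) =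
      LinearMap.mul' k R ∘ₗ TensorProduct.map g v := by
    ext a b
    simp
  rw [leftMul, this]
  rfl

theorem rightMul_eq (v g : H →ₗ[k] R) : rightMul v g = (toConv v * toConv g).ofConv := by
  have : TensorProduct.lift ((Algebra.lsmul k k R).toLinearMap.compl₁₂ g v).flip =
      LinearMap.mul' k R ∘ₗ TensorProduct.map v g := by
    ext a b
    simp [mul_comm]
  rw [rightMul, this]
  rfl

/-- The matrix of a connection as an element of the convolution algebra. -/
noncomputable def Conn.toLin (A : Conn k H R) : WithConv (H →ₗ[k] R) := toConv A.toHom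

theorem Conn.toLin_injective : Function.Injective (Conn.toLin (k := k) (H := H) (R := R)) :=
  toConv_injective.comp Conn.toHom_injective

theorem Conn.toLin_sub (A B : Conn k H R) : (A - B).toLin = A.toLin - B.toLin :=
  congrArg toConv (map_sub Conn.toHom A B)

theorem adjointAction_sub_dlog (d : Derivation k R R) (g : GroupPoints k H R) (A : Conn k H R) :
    toConv (adjointAction g A.toHom - dlog d g) =
      (g.toLin * A.toLin - convDeriv d g.toLin) * g.inverse.toLin := by
  rw [adjointAction, dlog, leftMul_eq, rightMul_eq, rightMul_eq, sub_mul]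
  rfl

/-- Multiplying by `g` on the right removes the inverse; in this form gauge transformations can be
composed and passed to limits. -/
theorem gaugeEquiv_iff {d : Derivation k R R} {A' A : Conn k H R} :
    GaugeEquiv d A' A ↔
      ∃ g : GroupPoints k H R, A'.toLin * g.toLin = g.toLin * A.toLin - convDeriv d g.toLin := by
  refine exists_congr fun g => ?_
  rw [← toConv_injective.eq_iff, adjointAction_sub_dlog]
  constructor
  · intro h
    change A'.toLin = _ at h
    rw [h, mul_assoc, GroupPoints.toLin_inverse_mul, mul_one]
  · intro h
    rw [← h, mul_assoc, GroupPoints.toLin_mul_inverse, mul_one]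
    rfl

theorem GaugeEquiv.symm {d : Derivation k R R} {A' A : Conn k H R} (h : GaugeEquiv d A' A) :
    GaugeEquiv d A A' := by
  rw [gaugeEquiv_iff] at *
  obtain ⟨g, hg⟩ := h
  refine ⟨g.inverse, ?_⟩
  -- Differentiating `g⁻¹ g = 1` gives `d(g⁻¹) = -g⁻¹ (dg) g⁻¹`.
  have h1 := convDeriv_mul d g.inverse.toLin g.toLin
  rw [GroupPoints.toLin_inverse_mul, convDeriv_one] at h1
  have h2 : convDeriv d g.inverse.toLin =
      - (g.inverse.toLin * convDeriv d g.toLin * g.inverse.toLin) := by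
    rw [eq_neg_iff_add_eq_zero, ← mul_one (convDeriv d g.inverse.toLin),
      ← GroupPoints.toLin_mul_inverse g, ← mul_assoc, ← add_mul, ← h1, zero_mul]
  have h3 : convDeriv d g.toLin = g.toLin * A.toLin - A'.toLin * g.toLin := by rw [hg]; abel
  rw [h2, h3]
  have e : g.inverse.toLin * (g.toLin * A.toLin - A'.toLin * g.toLin) * g.inverse.toLin =
      (g.inverse.toLin * g.toLin) * A.toLin * g.inverse.toLin -
        g.inverse.toLin * A'.toLin * (g.toLin * g.inverse.toLin) := by noncomm_ring
  rw [e, GroupPoints.toLin_inverse_mul, GroupPoints.toLin_mul_inverse, one_mul, mul_one]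
  abel

theorem GaugeEquiv.trans {d : Derivation k R R} {A'' A' A : Conn k H R} (h : GaugeEquiv d A'' A')
    (h' : GaugeEquiv d A' A) : GaugeEquiv d A'' A := by
  rw [gaugeEquiv_iff] at *
  obtain ⟨g, hg⟩ := h
  obtain ⟨g', hg'⟩ := h'
  refine ⟨g * g', ?_⟩
  rw [GroupPoints.toLin_mul, ← mul_assoc, hg, convDeriv_mul, sub_mul, mul_assoc, hg', mul_sub,
    mul_assoc]
  abel

/-- `v` is an `R`-valued tangent vector of `G` at the point `g`. -/
def IsTangentAt (g : GroupPoints k H R) (v : WithConv (H →ₗ[k] R)) : Prop :=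
  ∀ a b : H, v (a * b) = g.ofConv a * v b + g.ofConv b * v a

namespace IsTangentAt

variable {g : GroupPoints k H R} {v w : WithConv (H →ₗ[k] R)}

theorem sub (hv : IsTangentAt g v) (hw : IsTangentAt g w) : IsTangentAt g (v - w) := by
  intro a b
  change v _ - w _ = _ * (v b - w b) + _ * (v a - w a)
  rw [hv a b, hw a b]
  ring

/-- Comultiplication is multiplicative, so both sides become the same double sum. With `mul_left`
this shows that the gauge transform of a tangent vector at `1` is again one. -/
theorem mul_right (hv : IsTangentAt g v) (h : GroupPoints k H R) :
    IsTangentAt (g * h) (v * h.toLin) := by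
  intro a b
  rw [((ℛ k a).mul (ℛ k b)).convMul_apply, ← GroupPoints.toLin_apply, ← GroupPoints.toLin_apply,
    GroupPoints.toLin_mul, (ℛ k a).convMul_apply, (ℛ k b).convMul_apply, (ℛ k a).convMul_apply,
    (ℛ k b).convMul_apply, mul_comm (∑ i ∈ (ℛ k b).index, _), Finset.sum_mul_sum,
    Finset.sum_mul_sum, ← Finset.sum_add_distrib]
  refine (Finset.sum_product _ _ _).trans (Finset.sum_congr rfl fun i _ => ?_)
  rw [← Finset.sum_add_distrib]
  refine Finset.sum_congr rfl fun j _ => ?_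
  change v ((ℛ k a).left i * (ℛ k b).left j) * h.ofConv ((ℛ k a).right i * (ℛ k b).right j) = _
  rw [hv, map_mul]
  simp only [GroupPoints.toLin_apply]
  ring

theorem mul_left (hv : IsTangentAt g v) (h : GroupPoints k H R) :
    IsTangentAt (h * g) (h.toLin * v) := by
  intro a b
  rw [((ℛ k a).mul (ℛ k b)).convMul_apply, ← GroupPoints.toLin_apply, ← GroupPoints.toLin_apply,
    GroupPoints.toLin_mul, (ℛ k a).convMul_apply, (ℛ k b).convMul_apply, (ℛ k a).convMul_apply,
    (ℛ k b).convMul_apply, mul_comm (∑ i ∈ (ℛ k b).index, _), Finset.sum_mul_sum,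
    Finset.sum_mul_sum, ← Finset.sum_add_distrib]
  refine (Finset.sum_product _ _ _).trans (Finset.sum_congr rfl fun i _ => ?_)
  rw [← Finset.sum_add_distrib]
  refine Finset.sum_congr rfl fun j _ => ?_
  change h.ofConv ((ℛ k a).left i * (ℛ k b).left j) * v ((ℛ k a).right i * (ℛ k b).right j) = _
  rw [hv, map_mul]
  simp only [GroupPoints.toLin_apply]
  ring

theorem convDeriv (d : Derivation k R R) (g : GroupPoints k H R) :
    IsTangentAt g (convDeriv d g.toLin) := by
  intro a b
  simp [convDeriv_apply, GroupPoints.toLin_apply]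

/-- The defect of `v * w` from the Leibniz rule is symmetric in `v` and `w`, so it disappears in the
commutator. -/
theorem mul_apply_mul (hv : IsTangentAt 1 v) (hw : IsTangentAt 1 w) (a b : H) :
    (v * w) (a * b) = (1 : GroupPoints k H R).ofConv a * (v * w) b +
      (1 : GroupPoints k H R).ofConv b * (v * w) a + (v a * w b + w a * v b) := by
  have h1 : ∀ a, (1 : GroupPoints k H R).ofConv a = (1 * 1 : WithConv (H →ₗ[k] R)) a := by
    intro a
    rw [mul_one]
    rfl
  have h2 : ∀ a, v a = (v * 1) a := fun a => by rw [mul_one]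
  have h2' : ∀ a, v a = (1 * v) a := fun a => by rw [one_mul]
  have h3 : ∀ a, w a = (1 * w) a := fun a => by rw [one_mul]
  have h3' : ∀ a, w a = (w * 1) a := fun a => by rw [mul_one]
  rw [((ℛ k a).mul (ℛ k b)).convMul_apply, h1, h1, h2 a, h3 b, h3 a, h2 b,
    mul_comm ((1 * 1 : WithConv (H →ₗ[k] R)) b)]
  simp only [(ℛ k a).convMul_apply, (ℛ k b).convMul_apply, Finset.sum_mul_sum,
    ← Finset.sum_add_distrib]
  refine (Finset.sum_product _ _ _).trans (Finset.sum_congr rfl fun i _ => ?_)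
  refine Finset.sum_congr rfl fun j _ => ?_
  change v ((ℛ k a).left i * (ℛ k b).left j) * w ((ℛ k a).right i * (ℛ k b).right j) = _
  rw [hv, hw]
  simp only [← GroupPoints.toLin_apply, GroupPoints.toLin_one]
  ring

/-- The bracket of two tangent vectors at the unit element. -/
theorem bracket (hv : IsTangentAt 1 v) (hw : IsTangentAt 1 w) :
    IsTangentAt 1 (v * w - w * v) := by
  intro a b
  change (v * w) _ - (w * v) _ = _ * ((v * w) _ - (w * v) _) + _ * ((v * w) _ - (w * v) _)
  rw [mul_apply_mul hv hw, mul_apply_mul hw hv]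
  ring

end IsTangentAt

theorem Conn.isTangentAt_toLin (A : Conn k H R) : IsTangentAt 1 A.toLin := by
  induction A using TensorProduct.induction_on with
  | zero =>
    intro a b
    change (0 : R) = _ * 0 + _ * 0
    ring
  | add A B hA hB =>
    intro a b
    have h : Conn.toLin (A + B) = Conn.toLin A + Conn.toLin B :=
      congrArg toConv (map_add Conn.toHom A B)
    rw [h]
    change Conn.toLin A _ + Conn.toLin B _ = _ * (Conn.toLin A _ + Conn.toLin B _) +
      _ * (Conn.toLin A _ + Conn.toLin B _)
    rw [hA, hB]
    ring
  | tmul D r =>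
    intro a b
    have h : ∀ a, Conn.toLin (D ⊗ₜ[k] r : Conn k H R) a = LieAlg.incl k H D a • r := fun a => rfl
    have hD : LieAlg.incl k H D (a * b) = counit (R := k) a * LieAlg.incl k H D b +
      counit (R := k) b * LieAlg.incl k H D a := D.2 a b
    have h1 : ∀ a, (1 : GroupPoints k H R).ofConv a = algebraMap k R (counit a) := fun a => rfl
    rw [h, h, h, hD, h1, h1, add_smul, mul_smul, mul_smul, Algebra.smul_def (counit a),
      Algebra.smul_def (counit b)]

/-! ### Coordinates on the tangent space -/

/-- A point derivation is determined by its values on finitely many algebra generators. -/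
theorem LieAlg.finite [Algebra.FiniteType k H] : Module.Finite k (LieAlg k H) := by
  obtain ⟨s, hs⟩ := Algebra.FiniteType.out (R := k) (A := H)
  let ev : LieAlg k H →ₗ[k] (s → k) :=
    LinearMap.pi fun a => LinearMap.applyₗ (a : H) ∘ₗ LieAlg.incl k H
  refine Module.Finite.of_injective ev ((injective_iff_map_eq_zero _).2 fun D hD => ?_)
  apply LieAlg.incl_injective
  ext a
  have hmul : ∀ a b : H, LieAlg.incl k H D (a * b) = counit (R := k) a * LieAlg.incl k H D b +
      counit (R := k) b * LieAlg.incl k H D a := D.2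
  have h1 : LieAlg.incl k H D 1 = 0 := by simpa using hmul 1 1
  have ha : a ∈ Algebra.adjoin k (s : Set H) := hs ▸ Algebra.mem_top
  change LieAlg.incl k H D a = 0
  induction ha using Algebra.adjoin_induction with
  | mem x hx => exact congrFun hD ⟨x, hx⟩
  | algebraMap r => rw [Algebra.algebraMap_eq_smul_one, map_smul, h1, smul_zero]
  | add x y _ _ hx hy => rw [map_add, hx, hy, add_zero]
  | mul x y _ _ hx hy => rw [hmul, hx, hy, mul_zero, mul_zero, add_zero]

/-- Regular functions that are dual to a basis of the Lie algebra. -/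
theorem LieAlg.exists_dual [Module.Finite k (LieAlg k H)] :
    ∃ φ : Fin (Module.finrank k (LieAlg k H)) → H, ∀ D : LieAlg k H,
      ∀ i, LieAlg.incl k H D (φ i) = (Module.finBasis k (LieAlg k H)).repr D i := by
  have h : Function.Surjective (LieAlg.incl k H).flip :=
    LinearMap.flip_surjective_iff₁.2 (LieAlg.incl_injective k H)
  choose φ hφ using fun i => h ((Module.finBasis k (LieAlg k H)).coord i)
  exact ⟨φ, fun D i => LinearMap.congr_fun (hφ i) D⟩

variable [Module.Finite k (LieAlg k H)]

variable (k H) in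
/-- Regular functions on `G` that restrict to coordinates on the Lie algebra. -/
noncomputable def lieCoord : Fin (Module.finrank k (LieAlg k H)) → H :=
  (LieAlg.exists_dual (k := k) (H := H)).choose

variable (k H) in
/-- The tangent vector with given coordinates. -/
noncomputable def tangentOf (x : Fin (Module.finrank k (LieAlg k H)) → R) : Conn k H R :=
  ∑ i, Module.finBasis k (LieAlg k H) i ⊗ₜ[k] x i

theorem tangentOf_toLin_apply (x : Fin (Module.finrank k (LieAlg k H)) → R) (a : H) :
    (tangentOf k H x).toLin a =
      ∑ i, LieAlg.incl k H (Module.finBasis k (LieAlg k H) i) a • x i := by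
  change (tangentOf k H x).toHom a = _
  rw [tangentOf, map_sum, LinearMap.sum_apply]
  rfl

theorem tangentOf_toLin_lieCoord (x : Fin (Module.finrank k (LieAlg k H)) → R)
    (i : Fin (Module.finrank k (LieAlg k H))) : (tangentOf k H x).toLin (lieCoord k H i) = x i := by
  classical
  rw [tangentOf_toLin_apply, Finset.sum_eq_single i]
  · rw [lieCoord, (LieAlg.exists_dual (k := k) (H := H)).choose_spec]
    simp
  · intro j _ hj
    rw [lieCoord, (LieAlg.exists_dual (k := k) (H := H)).choose_spec]
    simp [hj]
  · simp

/-- Composing `v` with a `k`-linear functional on `R` gives an ordinary element of `𝔤`, for which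
the coordinate functions are dual to the basis; functionals separate the points of `R`. -/
theorem IsTangentAt.eq_tangentOf {v : WithConv (H →ₗ[k] R)} (hv : IsTangentAt 1 v) :
    v = (tangentOf k H fun i => v (lieCoord k H i)).toLin := by
  ext a
  change v a = (tangentOf k H fun i => v (lieCoord k H i)).toLin a
  rw [tangentOf_toLin_apply, ← sub_eq_zero, ← Module.forall_dual_apply_eq_zero_iff k]
  intro l
  let D : LieAlg k H := ⟨l ∘ₗ v.ofConv, fun a b => by
    have h1 : ∀ a, (1 : GroupPoints k H R).ofConv a = algebraMap k R (counit a) := fun a => rfl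
    change l (v (a * b)) = _ * l (v b) + _ * l (v a)
    rw [hv a b, h1, h1, ← Algebra.smul_def, ← Algebra.smul_def, map_add, map_smul, map_smul,
      smul_eq_mul, smul_eq_mul]⟩
  have hD : ∀ a, LieAlg.incl k H D a = l (v a) := fun a => rfl
  have hsum := (Module.finBasis k (LieAlg k H)).sum_repr D
  rw [map_sub, sub_eq_zero, ← hD]
  conv_lhs => rw [← hsum]
  rw [map_sum, LinearMap.sum_apply, map_sum]
  refine Finset.sum_congr rfl fun i _ => ?_
  rw [map_smul, LinearMap.smul_apply, map_smul, lieCoord, ← hD,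
    (LieAlg.exists_dual (k := k) (H := H)).choose_spec, smul_eq_mul, smul_eq_mul, mul_comm]

theorem exists_conn_toLin_eq {v : WithConv (H →ₗ[k] R)} (hv : IsTangentAt 1 v) :
    ∃ A : Conn k H R, A.toLin = v := ⟨_, hv.eq_tangentOf.symm⟩

end Convolution

/-! ### The `t`-adic filtration of the convolution algebra -/

section ConvolutionFiltration

open WithConv Coalgebra

variable {k : Type u} [Field k] {H : Type v} [CommRing H] [HopfAlgebra k H]

theorem conv_ext {R : Type*} [CommRing R] [Algebra k R] {v w : WithConv (H →ₗ[k] R)}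
    (h : ∀ a, v a = w a) : v = w :=
  ofConv_injective (LinearMap.ext h)

variable (k H) in
/-- The functionals on `𝒪(G)` with values in `t^n k[[t]]`. -/
def linFil (n : ℤ) : AddSubgroup (WithConv (H →ₗ[k] k⸨X⸩)) where
  carrier := {v | ∀ a, v a ∈ tFil k n}
  add_mem' hv hw a := add_mem (hv a) (hw a)
  zero_mem' _ := zero_mem _
  neg_mem' hv a := neg_mem (hv a)

theorem linFil_antitone {m n : ℤ} (h : m ≤ n) : linFil k H n ≤ linFil k H m :=
  fun _ hv a => tFil_antitone h (hv a)

theorem mul_mem_linFil {m n l : ℤ} {v w : WithConv (H →ₗ[k] k⸨X⸩)} (hv : v ∈ linFil k H m)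
    (hw : w ∈ linFil k H n) (h : l ≤ m + n) : v * w ∈ linFil k H l := by
  intro a
  rw [(ℛ k a).convMul_apply]
  exact sum_mem fun i _ => mul_mem_tFil (hv _) (hw _) h

theorem convDeriv_mem_linFil {m n : ℤ} {v : WithConv (H →ₗ[k] k⸨X⸩)} (hv : v ∈ linFil k H n)
    (h : m ≤ n - 1) : convDeriv (laurentD k) v ∈ linFil k H m :=
  fun a => laurentD_mem_tFil (hv a) h

theorem one_mem_linFil : (1 : WithConv (H →ₗ[k] k⸨X⸩)) ∈ linFil k H 0 :=
  fun _ => algebraMap_mem_tFil _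

theorem eq_zero_of_forall_mem_linFil {v : WithConv (H →ₗ[k] k⸨X⸩)} (c : ℤ)
    (h : ∀ n : ℕ, v ∈ linFil k H (n + c)) : v = 0 := by
  refine conv_ext fun a => ?_
  exact eq_zero_of_forall_mem_tFil c fun n => h n a

theorem inverse_mem_linFil {g : GroupPoints k H k⸨X⸩} (hg : g.toLin ∈ linFil k H 0) :
    g.inverse.toLin ∈ linFil k H 0 :=
  fun a => hg (HopfAlgebra.antipode k a)

theorem IsTangentAt.convDeriv_one {R : Type*} [CommRing R] [Algebra k R] (d : Derivation k R R)
    {v : WithConv (H →ₗ[k] R)} (hv : IsTangentAt 1 v) : IsTangentAt 1 (_root_.convDeriv d v) := by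
  intro a b
  have h1 : ∀ a, (1 : GroupPoints k H R).ofConv a = algebraMap k R (counit a) := fun a => rfl
  rw [convDeriv_apply, hv a b]
  simp [h1, convDeriv_apply]

theorem IsTangentAt.add {R : Type*} [CommRing R] [Algebra k R] {g : GroupPoints k H R}
    {v w : WithConv (H →ₗ[k] R)} (hv : IsTangentAt g v) (hw : IsTangentAt g w) :
    IsTangentAt g (v + w) := by
  intro a b
  change v _ + w _ = _ * (v b + w b) + _ * (v a + w a)
  rw [hv a b, hw a b]
  ring

variable [Module.Finite k (LieAlg k H)]

theorem tangentOf_mem_linFil {n : ℤ} {x : Fin (Module.finrank k (LieAlg k H)) → k⸨X⸩}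
    (hx : x ∈ piFil k _ n) : (tangentOf k H x).toLin ∈ linFil k H n := by
  intro a
  rw [tangentOf_toLin_apply]
  exact sum_mem fun i _ => (tFil k n).smul_mem _ (hx i)

theorem exists_mem_linFil (A : Conn k H k⸨X⸩) : ∃ n : ℤ, A.toLin ∈ linFil k H n := by
  rw [A.isTangentAt_toLin.eq_tangentOf]
  obtain ⟨n, hn⟩ := exists_forall_mem_tFil fun i => A.toLin (lieCoord k H i)
  exact ⟨n, tangentOf_mem_linFil hn⟩

theorem mem_tLattice_iff {n : ℕ} {A : Conn k H k⸨X⸩} :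
    A ∈ tLattice k H n ↔ A.toLin ∈ linFil k H n := by
  constructor
  · rintro ⟨B, rfl⟩
    induction B using TensorProduct.induction_on with
    | zero =>
      intro a
      rw [map_zero]
      exact zero_mem (tFil k n)
    | add B C hB hC =>
      intro a
      rw [map_add]
      have := add_mem (hB a) (hC a)
      convert this using 1
      exact LinearMap.congr_fun (map_add Conn.toHom _ _) a
    | tmul D p =>
      intro a
      exact (tFil k n).smul_mem (LieAlg.incl k H D a) (mem_range_tPowMul_iff.1 ⟨p, rfl⟩)
  · intro h
    rw [Conn.toLin_injective A.isTangentAt_toLin.eq_tangentOf, tangentOf]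
    refine sum_mem fun i _ => ?_
    obtain ⟨p, hp⟩ := mem_range_tPowMul_iff.2 (h (lieCoord k H i))
    exact ⟨Module.finBasis k (LieAlg k H) i ⊗ₜ p, by rw [LinearMap.lTensor_tmul, hp]⟩

/-- The linearised gauge equation is solvable, with a bounded loss. -/
theorem exists_covariantDerivative_eq [CharZero k] (A : Conn k H k⸨X⸩) :
    ∃ c n₀ : ℤ, ∀ n ≥ n₀, ∀ y : WithConv (H →ₗ[k] k⸨X⸩), IsTangentAt 1 y → y ∈ linFil k H n →
      ∃ x ∈ linFil k H (n - c), IsTangentAt 1 x ∧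
        convDeriv (laurentD k) x + (A.toLin * x - x * A.toLin) = y := by
  let N (v : WithConv (H →ₗ[k] k⸨X⸩)) : WithConv (H →ₗ[k] k⸨X⸩) :=
    convDeriv (laurentD k) v + (A.toLin * v - v * A.toLin)
  have hNtan : ∀ v, IsTangentAt 1 v → IsTangentAt 1 (N v) := fun v hv =>
    (hv.convDeriv_one _).add (A.isTangentAt_toLin.bracket hv)
  have hNadd : ∀ v w, N (v + w) = N v + N w := by
    intro v w
    simp only [N, convDeriv_add, mul_add, add_mul]
    abel
  have hNsmul : ∀ (f : k⸨X⸩) v, N (f • v) = laurentD k f • v + f • N v := by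
    intro f v
    have h1 : convDeriv (laurentD k) (f • v) =
        laurentD k f • v + f • convDeriv (laurentD k) v := by
      refine conv_ext fun a => ?_
      change laurentD k (f * v a) = laurentD k f * v a + f * laurentD k (v a)
      rw [Derivation.leibniz, smul_eq_mul, smul_eq_mul]
      ring
    simp only [N, h1, mul_smul_comm, smul_mul_assoc, smul_add, smul_sub]
    abel
  have htadd : ∀ x y : Fin (Module.finrank k (LieAlg k H)) → k⸨X⸩,
      (tangentOf k H (x + y)).toLin = (tangentOf k H x).toLin + (tangentOf k H y).toLin := by
    intro x y
    refine conv_ext fun a => ?_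
    change (tangentOf k H (x + y)).toLin a = (tangentOf k H x).toLin a + (tangentOf k H y).toLin a
    simp only [tangentOf_toLin_apply, Pi.add_apply, smul_add, Finset.sum_add_distrib]
  have htsmul : ∀ (f : k⸨X⸩) (x : Fin (Module.finrank k (LieAlg k H)) → k⸨X⸩),
      (tangentOf k H (f • x)).toLin = f • (tangentOf k H x).toLin := by
    intro f x
    refine conv_ext fun a => ?_
    change (tangentOf k H (f • x)).toLin a = f * (tangentOf k H x).toLin a
    simp only [tangentOf_toLin_apply, Pi.smul_apply, Finset.mul_sum, smul_eq_mul, mul_smul_comm]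
  -- In coordinates on `𝔤` the operator `N = d + [A, ·]` is a connection on a free `k((t))`-module
  -- of finite rank.
  let D : (Fin (Module.finrank k (LieAlg k H)) → k⸨X⸩) →+
      (Fin (Module.finrank k (LieAlg k H)) → k⸨X⸩) := AddMonoidHom.mk'
    (fun x i => N (tangentOf k H x).toLin (lieCoord k H i)) fun x y => by
      rw [htadd, hNadd]
      rfl
  have hD : ∀ (f : k⸨X⸩) x, D (f • x) = laurentD k f • x + f • D x := by
    intro f x
    ext1 i
    change N (tangentOf k H (f • x)).toLin (lieCoord k H i) =
      laurentD k f * x i + f * N (tangentOf k H x).toLin (lieCoord k H i)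
    rw [htsmul, hNsmul, ← tangentOf_toLin_lieCoord x i]
    rfl
  obtain ⟨c, n₀, h⟩ := exists_connection_eq D hD
  refine ⟨c, n₀, fun n hn y hy hyn => ?_⟩
  obtain ⟨x, hx, hxe⟩ := h n hn (fun i => y (lieCoord k H i)) fun i => hyn _
  refine ⟨_, tangentOf_mem_linFil hx, (tangentOf k H x).isTangentAt_toLin, ?_⟩
  change N _ = y
  rw [hy.eq_tangentOf, (hNtan _ (tangentOf k H x).isTangentAt_toLin).eq_tangentOf, ← hxe]
  rfl

end ConvolutionFiltration

/-! ### Openness of the gauge equivalence classes -/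

section Newton

open WithConv Coalgebra

variable {k : Type u} [Field k] {H : Type v} [CommRing H] [HopfAlgebra k H]

variable (k) in
/-- The inclusion of `k[[t]]` in `k((t))`. -/
noncomputable def coeAlgHom : k⟦X⟧ →ₐ[k] k⸨X⸩ :=
  { HahnSeries.ofPowerSeries ℤ k with
    commutes' := fun c => by
      change ((PowerSeries.C c : k⟦X⟧) : k⸨X⸩) = _
      rw [PowerSeries.coe_C]
      rfl }

theorem coeAlgHom_injective : Function.Injective (coeAlgHom k) :=
  HahnSeries.ofPowerSeries_injective

/-- This allows formal smoothness to lift a point modulo `t^N` directly to `k[[t]]`. -/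
instance PowerSeries.isAdicComplete_span_X_pow (N : ℕ) [NeZero N] :
    IsAdicComplete (Ideal.span {(PowerSeries.X : k⟦X⟧) ^ N}) k⟦X⟧ where
  haus' f hf := by
    ext j
    have := hf (j + 1)
    rw [SModEq.zero, smul_eq_mul, Ideal.mul_top, Ideal.span_singleton_pow,
      Ideal.mem_span_singleton, ← pow_mul, PowerSeries.X_pow_dvd_iff] at this
    exact this j (by nlinarith [NeZero.pos N])
  prec' f hf := by
    refine ⟨PowerSeries.mk fun j => PowerSeries.coeff j (f (j + 1)), fun n => ?_⟩
    rw [SModEq.sub_mem, smul_eq_mul, Ideal.mul_top, Ideal.span_singleton_pow,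
      Ideal.mem_span_singleton, ← pow_mul, PowerSeries.X_pow_dvd_iff]
    intro j hj
    have key : ∀ {a b : ℕ}, a ≤ b → j < N * a →
        PowerSeries.coeff j (f a) = PowerSeries.coeff j (f b) := by
      intro a b hab hja
      have := hf hab
      rw [SModEq.sub_mem, smul_eq_mul, Ideal.mul_top, Ideal.span_singleton_pow,
        Ideal.mem_span_singleton, ← pow_mul, PowerSeries.X_pow_dvd_iff] at this
      have := this j hja
      rwa [map_sub, sub_eq_zero] at this
    rw [map_sub, PowerSeries.coeff_mk, sub_eq_zero]
    rcases le_total n (j + 1) with h | h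
    · exact key h hj
    · exact (key h (by nlinarith [NeZero.pos N])).symm

/-- A small tangent vector at the unit is the first order part of a point of `G`. -/
theorem exists_point_of_tangent [Algebra.FormallySmooth k H] {m : ℕ} (hm : 0 < m)
    {x : WithConv (H →ₗ[k] k⸨X⸩)} (hx : IsTangentAt 1 x) (hxm : x ∈ linFil k H m) :
    ∃ h : GroupPoints k H k⸨X⸩, h.toLin ∈ linFil k H 0 ∧ h.toLin - 1 - x ∈ linFil k H (2 * m) := by
  have hrange : ∀ a, x.ofConv a ∈ LinearMap.range (coeAlgHom k).toLinearMap := fun a =>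
    exists_coe_eq (tFil_antitone (by omega) (hxm a))
  let e := LinearEquiv.ofInjective (coeAlgHom k).toLinearMap coeAlgHom_injective
  let y : H →ₗ[k] k⟦X⟧ := e.symm.toLinearMap ∘ₗ x.ofConv.codRestrict _ hrange
  have hy : ∀ a, (y a : k⸨X⸩) = x a := fun a =>
    congrArg Subtype.val (e.apply_symm_apply (x.ofConv.codRestrict _ hrange a))
  have hyd : ∀ a, PowerSeries.X ^ m ∣ y a := fun a => coe_mem_tFil_iff.1 (hy a ▸ hxm a)
  have hymul : ∀ a b, y (a * b) = counit (R := k) a • y b + counit (R := k) b • y a := by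
    intro a b
    apply coeAlgHom_injective (k := k)
    have h1 : ∀ a, (1 : GroupPoints k H k⸨X⸩).ofConv a = algebraMap k k⸨X⸩ (counit a) :=
      fun a => rfl
    rw [map_add, map_smul, map_smul, Algebra.smul_def, Algebra.smul_def, ← h1, ← h1]
    exact ((hy _).trans (hx a b)).trans (by rw [← hy a, ← hy b]; rfl)
  -- The map `counit + y` fails to be multiplicative only by `-y(a) y(b)`, which is divisible by
  -- `X^(2m)`. It is therefore a point of `G` modulo `X^(2m)`.
  let I : Ideal k⟦X⟧ := Ideal.span {PowerSeries.X ^ (2 * m)}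
  have : NeZero (2 * m) := ⟨by omega⟩
  let f₀ : H →ₗ[k] k⟦X⟧ := Algebra.linearMap k k⟦X⟧ ∘ₗ counit + y
  have hf₀ : ∀ a, f₀ a = algebraMap k k⟦X⟧ (counit a) + y a := fun a => rfl
  let f : H →ₐ[k] k⟦X⟧ ⧸ I := AlgHom.ofLinearMap ((Ideal.Quotient.mkₐ k I).toLinearMap ∘ₗ f₀)
    (by
      change Ideal.Quotient.mk I (f₀ 1) = 1
      have : y 1 = 0 := by simpa using hymul 1 1
      rw [hf₀, this]
      simp)
    (by
      intro a b
      change Ideal.Quotient.mk I (f₀ (a * b)) =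
        Ideal.Quotient.mk I (f₀ a) * Ideal.Quotient.mk I (f₀ b)
      rw [← map_mul, Ideal.Quotient.eq, Ideal.mem_span_singleton, hf₀, hf₀, hf₀, hymul,
        Bialgebra.counit_mul, map_mul, Algebra.smul_def, Algebra.smul_def]
      convert (dvd_neg.2 (mul_dvd_mul (hyd a) (hyd b))) using 1
      · ring
      · ring)
  obtain ⟨g, hg⟩ := Algebra.FormallySmooth.exists_mkₐ_comp_eq_of_isAdicComplete f
  refine ⟨toConv ((coeAlgHom k).comp g), fun a => coe_mem_tFil (g a), fun a => ?_⟩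
  have h1 : Ideal.Quotient.mk I (g a) = Ideal.Quotient.mk I (f₀ a) := DFunLike.congr_fun hg a
  rw [Ideal.Quotient.eq, Ideal.mem_span_singleton, ← coe_mem_tFil_iff, hf₀] at h1
  change coeAlgHom k _ ∈ _ at h1
  rw [map_sub, map_add, AlgHom.commutes, ← sub_sub] at h1
  change coeAlgHom k (g a) - algebraMap k k⸨X⸩ (counit a) - x a ∈ _
  rw [← hy]
  exact_mod_cast h1

/-- Convergence of sequences of points of `G`. -/
theorem exists_point_limit (m : ℤ) (p : ℕ → GroupPoints k H k⸨X⸩)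
    (hp : ∀ s : ℕ, (p (s + 1)).toLin - (p s).toLin ∈ linFil k H (m + s)) :
    ∃ q : GroupPoints k H k⸨X⸩, ∀ s : ℕ, q.toLin - (p s).toLin ∈ linFil k H (m + s) := by
  choose q hq using fun a => exists_tFil_limit m (fun s => (p s).ofConv a) fun s => hp s a
  have uniq : ∀ (c : ℤ) (f g : k⸨X⸩), (∀ s : ℕ, f - g ∈ tFil k (s + c)) → f = g :=
    fun c f g h => sub_eq_zero.1 (eq_zero_of_forall_mem_tFil c h)
  have hmul : ∀ a b, q (a * b) = q a * q b := by
    intro a b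
    obtain ⟨c, hc⟩ := exists_mem_tFil (q a)
    obtain ⟨c', hc'⟩ := exists_mem_tFil ((p 0).ofConv b)
    -- A lower bound uniform in `s` is needed to make `(q a - p_s a) p_s b` tend to zero.
    have hb : ∀ s, (p s).ofConv b ∈ tFil k (min c' m) := by
      intro s
      have h1 := tFil_antitone (show min c' m ≤ m + s by omega) (hq b s)
      have h2 := tFil_antitone (show min c' m ≤ m + (0 : ℕ) by omega) (hq b 0)
      have h3 := tFil_antitone (show min c' m ≤ c' by omega) hc'
      have := sub_mem (add_mem h2 h3) h1
      rwa [sub_add_cancel, sub_sub_cancel] at this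
    refine uniq (m + min 0 (min c (min c' m))) _ _ fun s => ?_
    have h1 := tFil_antitone (show s + (m + min 0 (min c (min c' m))) ≤ m + s by omega)
      (hq (a * b) s)
    have h2 := mul_mem_tFil (l := s + (m + min 0 (min c (min c' m)))) (hq a s) (hb s) (by omega)
    have h3 := mul_mem_tFil (l := s + (m + min 0 (min c (min c' m)))) hc (hq b s) (by omega)
    have := sub_mem h1 (add_mem h2 h3)
    convert this using 1
    rw [map_mul]
    ring
  let Q : H →ₐ[k] k⸨X⸩ :=
    { toFun := q
      map_one' := uniq m _ _ fun s => by
        have := hq 1 s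
        rwa [map_one, add_comm] at this
      map_mul' := hmul
      map_zero' := uniq m _ _ fun s => by
        have := hq 0 s
        rwa [map_zero, add_comm] at this
      map_add' := fun a b => uniq m _ _ fun s => by
        have := sub_mem (hq (a + b) s) (add_mem (hq a s) (hq b s))
        rw [add_comm (s : ℤ)]
        convert this using 1
        rw [map_add]
        ring
      commutes' := fun c => uniq m _ _ fun s => by
        have := hq (algebraMap k H c) s
        rwa [AlgHom.commutes, add_comm] at this }
  exact ⟨toConv Q, fun s a => hq a s⟩

variable [Module.Finite k (LieAlg k H)] [Algebra.FormallySmooth k H]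

/-- One step of Newton's method. -/
theorem exists_newton_step [CharZero k] (A : Conn k H k⸨X⸩) :
    ∃ c N : ℤ, ∀ n ≥ N, ∀ A' : Conn k H k⸨X⸩, (A' - A).toLin ∈ linFil k H n →
      ∃ (A'' : Conn k H k⸨X⸩) (h : GroupPoints k H k⸨X⸩),
        (A'' - A).toLin ∈ linFil k H (n + 1) ∧ h.toLin - 1 ∈ linFil k H (n - c) ∧
        h.toLin ∈ linFil k H 0 ∧
        A''.toLin * h.toLin = h.toLin * A'.toLin - convDeriv (laurentD k) h.toLin := by
  obtain ⟨r, hr⟩ := exists_mem_linFil A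
  obtain ⟨c, n₀, hsol⟩ := exists_covariantDerivative_eq A
  -- The bounds make `n - c` positive and bring each error term to order at least `n + 1`: `x (A' -
  -- A)` has order at least `2n - c`, `[z, A]` at least `2(n - c) + r`, and `dz` at least `2(n - c)
  -- - 1`.
  refine ⟨c, max n₀ (max 0 (max (2 * c + 2) (max (c + 1) (max (1 + 2 * c - r) (2 * c + 1 - r))))),
    fun n hn A' hA' => ?_⟩
  obtain ⟨x, hx, hxt, hxe⟩ := hsol n (by omega) _ (A' - A).isTangentAt_toLin hA'
  have hm : ((n - c).toNat : ℤ) = n - c := Int.toNat_of_nonneg (by omega)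
  obtain ⟨h, h0, hz⟩ := exists_point_of_tangent (m := (n - c).toNat) (by omega) hxt (by rwa [hm])
  rw [hm] at hz
  set z := h.toLin - 1 - x with hzdef
  have hh : h.toLin = 1 + x + z := by rw [hzdef]; abel
  have htan : IsTangentAt 1 ((h.toLin * A'.toLin - convDeriv (laurentD k) h.toLin) *
      h.inverse.toLin) := by
    rw [sub_mul, ← h.mul_inverse]
    have h1 := (A'.isTangentAt_toLin.mul_left h).mul_right h.inverse
    rw [mul_one] at h1
    exact h1.sub ((IsTangentAt.convDeriv (laurentD k) h).mul_right h.inverse)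
  obtain ⟨A'', hA''⟩ := exists_conn_toLin_eq htan
  have hA''h : A''.toLin * h.toLin = h.toLin * A'.toLin - convDeriv (laurentD k) h.toLin := by
    rw [hA'', mul_assoc, GroupPoints.toLin_inverse_mul, mul_one]
  refine ⟨A'', h, ?_, ?_, h0, hA''h⟩
  · have e1 : (A'' - A).toLin = ((A''.toLin - A.toLin) * h.toLin) * h.inverse.toLin := by
      rw [mul_assoc, GroupPoints.toLin_mul_inverse, mul_one, Conn.toLin_sub]
    -- The first-order part `(A' - A) - (dx + [A, x])` vanishes by the choice of `x`; only terms
    -- quadratically small or involving `z` survive.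
    have e2 : (A''.toLin - A.toLin) * h.toLin = x * (A' - A).toLin + z * (A' - A).toLin +
        (z * A.toLin - A.toLin * z) - convDeriv (laurentD k) z := by
      have hA'A : A'.toLin = A.toLin + (A' - A).toLin := by rw [Conn.toLin_sub]; abel
      rw [sub_mul, hA''h, hh, convDeriv_add, convDeriv_add, convDeriv_one, hA'A]
      have hxe' : convDeriv (laurentD k) x =
          (A' - A).toLin - (A.toLin * x - x * A.toLin) := by rw [← hxe]; abel
      rw [hxe']
      noncomm_ring
    rw [e1, e2]
    refine mul_mem_linFil (m := n + 1) (n := 0) ?_ (inverse_mem_linFil h0) (by omega)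
    refine sub_mem (add_mem (add_mem ?_ ?_) (sub_mem ?_ ?_)) ?_
    · exact mul_mem_linFil hx hA' (by omega)
    · exact mul_mem_linFil hz hA' (by omega)
    · exact mul_mem_linFil hz hr (by omega)
    · exact mul_mem_linFil hr hz (by omega)
    · exact convDeriv_mem_linFil hz (by omega)
  · rw [hh, add_assoc, add_sub_cancel_left]
    exact add_mem hx (linFil_antitone (by omega) hz)

theorem gaugeEquiv_of_mem_linFil [CharZero k] (A : Conn k H k⸨X⸩) :
    ∃ n : ℕ, ∀ A' : Conn k H k⸨X⸩, (A' - A).toLin ∈ linFil k H n →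
      GaugeEquiv (laurentD k) A' A := by
  obtain ⟨r, hr⟩ := exists_mem_linFil A
  obtain ⟨c, N, hstep⟩ := exists_newton_step A
  -- `n ≥ N` makes the Newton step available at every stage; `n ≥ c` keeps the limit of the products
  -- integral.
  let n : ℕ := (max N (max c 0)).toNat
  have hnN : N ≤ n := by omega
  have hnc : c ≤ n := by omega
  refine ⟨n, fun A' hA' => GaugeEquiv.symm ?_⟩
  have step : ∀ (s : ℕ) (B : Conn k H k⸨X⸩), ∃ Bh : Conn k H k⸨X⸩ × GroupPoints k H k⸨X⸩,
      (B - A).toLin ∈ linFil k H (n + s) →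
        (Bh.1 - A).toLin ∈ linFil k H (n + (s + 1 : ℕ)) ∧
        Bh.2.toLin - 1 ∈ linFil k H (n - c + s) ∧ Bh.2.toLin ∈ linFil k H 0 ∧
        Bh.1.toLin * Bh.2.toLin = Bh.2.toLin * B.toLin - convDeriv (laurentD k) Bh.2.toLin := by
    intro s B
    by_cases hB : (B - A).toLin ∈ linFil k H (n + s)
    · obtain ⟨B', h, h1, h2, h3, h4⟩ := hstep (n + s) (by omega) B hB
      refine ⟨(B', h), fun _ => ⟨?_, ?_, h3, h4⟩⟩
      · exact linFil_antitone (by push_cast; omega) h1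
      · exact linFil_antitone (by omega) h2
    · exact ⟨(A, 1), fun h => absurd h hB⟩
  choose F hF using step
  -- The second component accumulates the product of the corrections, each new one on the left, so
  -- that it carries `A'` to the current approximation of `A`.
  let S : ℕ → Conn k H k⸨X⸩ × GroupPoints k H k⸨X⸩ := fun s =>
    Nat.rec (A', 1) (fun s Bp => ((F s Bp.1).1, (F s Bp.1).2 * Bp.2)) s
  have hB : ∀ s : ℕ, ((S s).1 - A).toLin ∈ linFil k H (n + s) := by
    intro s
    induction s with
    | zero => simpa [S] using hA'
    | succ s ih => exact (hF s (S s).1 ih).1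
  have hp0 : ∀ s : ℕ, (S s).2.toLin ∈ linFil k H 0 := by
    intro s
    induction s with
    | zero => exact one_mem_linFil
    | succ s ih => exact mul_mem_linFil (hF s (S s).1 (hB s)).2.2.1 ih (by omega)
  have heq : ∀ s : ℕ, (S s).1.toLin * (S s).2.toLin =
      (S s).2.toLin * A'.toLin - convDeriv (laurentD k) (S s).2.toLin := by
    intro s
    induction s with
    | zero =>
      change A'.toLin * 1 = 1 * A'.toLin - convDeriv (laurentD k) 1
      rw [convDeriv_one, mul_one, one_mul, sub_zero]
    | succ s ih =>
      have h4 := (hF s (S s).1 (hB s)).2.2.2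
      change (F s (S s).1).1.toLin * ((F s (S s).1).2 * (S s).2).toLin =
        ((F s (S s).1).2 * (S s).2).toLin * A'.toLin -
          convDeriv (laurentD k) ((F s (S s).1).2 * (S s).2).toLin
      rw [GroupPoints.toLin_mul, ← mul_assoc, h4, sub_mul, mul_assoc, ih, convDeriv_mul, mul_sub,
        mul_assoc]
      abel
  obtain ⟨q, hq⟩ := exists_point_limit (n - c) (fun s => (S s).2) fun s => by
    have e : (S (s + 1)).2.toLin - (S s).2.toLin =
        ((F s (S s).1).2.toLin - 1) * (S s).2.toLin := by
      rw [sub_mul, one_mul]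
      rfl
    rw [e]
    exact mul_mem_linFil (hF s (S s).1 (hB s)).2.1 (hp0 s) (by omega)
  obtain ⟨r', hr'⟩ := exists_mem_linFil A'
  have hq0 : q.toLin ∈ linFil k H 0 := by
    have := add_mem (linFil_antitone (by omega) (hq 0)) (hp0 0)
    rwa [sub_add_cancel] at this
  rw [gaugeEquiv_iff]
  refine ⟨q, ?_⟩
  rw [← sub_eq_zero]
  refine eq_zero_of_forall_mem_linFil (min r (min r' 0) - 1) fun s => ?_
  -- Subtracting the exact relation at stage `s` expresses the defect of `q` through `q - p_s` and
  -- `A_s - A`, both of order growing with `s`.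
  have e : A.toLin * q.toLin - (q.toLin * A'.toLin - convDeriv (laurentD k) q.toLin) =
      A.toLin * (q.toLin - (S s).2.toLin) - ((S s).1 - A).toLin * (S s).2.toLin -
        (q.toLin - (S s).2.toLin) * A'.toLin +
        convDeriv (laurentD k) (q.toLin - (S s).2.toLin) := by
    have h1 : convDeriv (laurentD k) (q.toLin - (S s).2.toLin) =
        convDeriv (laurentD k) q.toLin - convDeriv (laurentD k) (S s).2.toLin := by
      rw [eq_sub_iff_add_eq, ← convDeriv_add, sub_add_cancel]
    have h2 : convDeriv (laurentD k) (S s).2.toLin =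
        (S s).2.toLin * A'.toLin - (S s).1.toLin * (S s).2.toLin := by rw [heq]; abel
    rw [h1, h2, Conn.toLin_sub]
    noncomm_ring
  rw [e]
  refine add_mem (sub_mem (sub_mem ?_ ?_) ?_) ?_
  · exact mul_mem_linFil hr (hq s) (by omega)
  · exact mul_mem_linFil (hB s) (hp0 s) (by omega)
  · exact mul_mem_linFil (hq s) hr' (by omega)
  · exact convDeriv_mem_linFil (hq s) (by omega)

/-- Connections that are close enough are gauge equivalent. -/
theorem exists_forall_sub_mem_tLattice_gaugeEquiv [CharZero k] (A : Conn k H k⸨X⸩) :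
    ∃ n : ℕ, ∀ A' : Conn k H k⸨X⸩, A' - A ∈ tLattice k H n → GaugeEquiv (laurentD k) A' A := by
  obtain ⟨n, h⟩ := gaugeEquiv_of_mem_linFil A
  exact ⟨n, fun A' hA' => h A' (mem_tLattice_iff.1 hA')⟩

theorem isOpen_gaugeEquiv [CharZero k] (A : Conn k H k⸨X⸩) :
    @IsOpen _ (tAdicTopology k H) {A' : Conn k H k⸨X⸩ | GaugeEquiv (laurentD k) A' A} := by
  intro A' hA'
  obtain ⟨n, hn⟩ := exists_forall_sub_mem_tLattice_gaugeEquiv A'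
  exact ⟨n, fun A'' h => (hn A'' h).trans hA'⟩

end Newton

/-! ### Completions of discrete valuation rings containing their residue field -/

section Completion

variable {k : Type u} [Field k] {A : Type w} [CommRing A] [Algebra k A]

theorem aeval_mem_pow_of_X_pow_dvd {I : Ideal A} {π : A} (hπ : π ∈ I) {n : ℕ} {p : Polynomial k}
    (hp : Polynomial.X ^ n ∣ p) : Polynomial.aeval π p ∈ I ^ n := by
  obtain ⟨q, rfl⟩ := hp
  rw [map_mul, map_pow, Polynomial.aeval_X]
  exact Ideal.mul_mem_right _ _ (Ideal.pow_mem_pow hπ n)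

theorem mk_aeval_trunc_eq {I : Ideal A} {π : A} (hπ : π ∈ I) {n m : ℕ} {p : Polynomial k}
    {f : k⟦X⟧} (hp : ∀ i < n, p.coeff i = PowerSeries.coeff i f) (hmn : n ≤ m) :
    Ideal.Quotient.mk (I ^ n) (Polynomial.aeval π p) =
      Ideal.Quotient.mk (I ^ n) (Polynomial.aeval π (PowerSeries.trunc m f)) := by
  rw [Ideal.Quotient.eq, ← map_sub]
  refine aeval_mem_pow_of_X_pow_dvd hπ (Polynomial.X_pow_dvd_iff.2 fun i hi => ?_)
  rw [Polynomial.coeff_sub, PowerSeries.coeff_trunc, if_pos (by omega), hp i hi, sub_self]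

/-- Evaluation of power series at `π ∈ I`, modulo `I ^ n`. -/
noncomputable def evalPowerSeriesMod {I : Ideal A} {π : A} (hπ : π ∈ I) (n : ℕ) :
    k⟦X⟧ →ₐ[k] A ⧸ I ^ n :=
  AlgHom.ofLinearMap ((Ideal.Quotient.mkₐ k (I ^ n)).toLinearMap ∘ₗ
      (Polynomial.aeval π).toLinearMap ∘ₗ PowerSeries.trunc n)
    (by
      change Ideal.Quotient.mk (I ^ n) (Polynomial.aeval π (PowerSeries.trunc n 1)) = 1
      rw [← mk_aeval_trunc_eq hπ (p := 1) (by simp [Polynomial.coeff_one, PowerSeries.coeff_one])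
        le_rfl]
      simp)
    (by
      intro f g
      change Ideal.Quotient.mk (I ^ n) (Polynomial.aeval π (PowerSeries.trunc n (f * g))) =
        Ideal.Quotient.mk (I ^ n) (Polynomial.aeval π (PowerSeries.trunc n f)) *
          Ideal.Quotient.mk (I ^ n) (Polynomial.aeval π (PowerSeries.trunc n g))
      rw [← map_mul, ← map_mul]
      refine (mk_aeval_trunc_eq hπ (fun i hi => ?_) le_rfl).symm
      rw [PowerSeries.coeff_mul_eq_coeff_trunc_mul_trunc f g hi, ← Polynomial.coe_mul,
        Polynomial.coeff_coe])

theorem evalPowerSeriesMod_apply {I : Ideal A} {π : A} (hπ : π ∈ I) (n : ℕ) (f : k⟦X⟧) :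
    evalPowerSeriesMod hπ n f =
      Ideal.Quotient.mk (I ^ n) (Polynomial.aeval π (PowerSeries.trunc n f)) := rfl

theorem factorₐ_comp_evalPowerSeriesMod {I : Ideal A} {π : A} (hπ : π ∈ I) {m n : ℕ}
    (hmn : m ≤ n) : (Ideal.Quotient.factorₐ k (Ideal.pow_le_pow_right hmn)).comp
      (evalPowerSeriesMod (k := k) hπ n) = evalPowerSeriesMod hπ m := by
  refine AlgHom.ext fun f => ?_
  change Ideal.Quotient.mk (I ^ m) (Polynomial.aeval π (PowerSeries.trunc n f)) =
    Ideal.Quotient.mk (I ^ m) (Polynomial.aeval π (PowerSeries.trunc m f))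
  refine mk_aeval_trunc_eq hπ (fun i hi => ?_) le_rfl
  rw [PowerSeries.coeff_trunc, if_pos (by omega)]

/-- Evaluation of power series at `π ∈ I`. -/
noncomputable def evalPowerSeries {I : Ideal A} {π : A} (hπ : π ∈ I) :
    k⟦X⟧ →ₐ[k] AdicCompletion I A :=
  AdicCompletion.liftAlgHom I (evalPowerSeriesMod hπ) (factorₐ_comp_evalPowerSeriesMod hπ)

theorem evalₐ_evalPowerSeries {I : Ideal A} {π : A} (hπ : π ∈ I) (n : ℕ) (f : k⟦X⟧) :
    AdicCompletion.evalₐ I n (evalPowerSeries hπ f) =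
      Ideal.Quotient.mk (I ^ n) (Polynomial.aeval π (PowerSeries.trunc n f)) := by
  rw [evalPowerSeries, AdicCompletion.evalₐ_liftAlgHom I _ (factorₐ_comp_evalPowerSeriesMod hπ),
    evalPowerSeriesMod_apply]

variable [IsLocalRing A] {π : A}

/-- If the lowest term of `f` is `c t^n`, its image modulo the `(n+1)`-st power of the maximal ideal
is `c π^n`. Were this zero, cancelling `π^n` would make `π` divide the unit `c`. -/
theorem evalPowerSeries_injective [IsDomain A]
    (hπ : IsLocalRing.maximalIdeal A = Ideal.span {π}) (hπ0 : π ≠ 0)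
    (hπm : π ∈ IsLocalRing.maximalIdeal A) :
    Function.Injective (evalPowerSeries (k := k) hπm) := by
  rw [injective_iff_map_eq_zero]
  intro f hf
  by_contra hf0
  obtain ⟨n, hn, hmin⟩ : ∃ n, PowerSeries.coeff n f ≠ 0 ∧ ∀ i < n, PowerSeries.coeff i f = 0 := by
    classical
    have h : ∃ n, PowerSeries.coeff n f ≠ 0 := by
      by_contra! h
      exact hf0 (PowerSeries.ext h)
    exact ⟨Nat.find h, Nat.find_spec h, fun i hi => not_not.1 (Nat.find_min h hi)⟩
  have h1 := evalₐ_evalPowerSeries hπm (n + 1) f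
  rw [hf, map_zero, PowerSeries.trunc_succ, eq_comm, Ideal.Quotient.eq_zero_iff_mem] at h1
  have h2 : PowerSeries.trunc n f = 0 := by
    ext i
    rw [PowerSeries.coeff_trunc]
    split_ifs with h
    · simp [hmin i h]
    · simp
  rw [h2, zero_add, Polynomial.aeval_monomial, hπ, Ideal.span_singleton_pow,
    Ideal.mem_span_singleton, pow_succ,
    mul_comm (algebraMap k A _)] at h1
  have h3 := (mul_dvd_mul_iff_left (pow_ne_zero n hπ0)).1 h1
  have h4 : IsUnit (algebraMap k A (PowerSeries.coeff n f)) := (isUnit_iff_ne_zero.2 hn).map _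
  exact hπm (isUnit_of_dvd_unit h3 h4)

theorem Ideal.map_eq_span_of_maximal {B : Type*} [CommRing B] [Algebra A B]
    (hπ : IsLocalRing.maximalIdeal A = Ideal.span {π}) :
    (IsLocalRing.maximalIdeal A).map (algebraMap A B) = Ideal.span {algebraMap A B π} := by
  rw [hπ, Ideal.map_span, Set.image_singleton]

theorem AdicCompletion.exists_eq_add_of_mul
    (hπ : IsLocalRing.maximalIdeal A = Ideal.span {π})
    (hres : ∀ a : A, ∃ c : k, a - algebraMap k A c ∈ IsLocalRing.maximalIdeal A)
    (y : AdicCompletion (IsLocalRing.maximalIdeal A) A) :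
    ∃ (c : k) (z : AdicCompletion (IsLocalRing.maximalIdeal A) A),
      y = algebraMap k _ c + algebraMap A _ π * z := by
  obtain ⟨a, ha⟩ := Ideal.Quotient.mk_surjective (AdicCompletion.evalOneₐ _ y)
  obtain ⟨c, hc⟩ := hres a
  have hfg : (IsLocalRing.maximalIdeal A).FG := ⟨{π}, by rw [hπ, Finset.coe_singleton]⟩
  have h1 : y - algebraMap k _ c ∈ (IsLocalRing.maximalIdeal A).map
      (algebraMap A (AdicCompletion (IsLocalRing.maximalIdeal A) A)) := by
    rw [← AdicCompletion.ker_evalOneₐ_eq_map _ hfg]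
    change AdicCompletion.evalOneₐ _ _ = 0
    rw [map_sub, ← ha, IsScalarTower.algebraMap_apply k A (AdicCompletion _ A), sub_eq_zero,
      AlgHom.commutes]
    exact Ideal.Quotient.eq.2 hc
  rw [Ideal.map_eq_span_of_maximal hπ, Ideal.mem_span_singleton] at h1
  obtain ⟨z, hz⟩ := h1
  exact ⟨c, z, by rw [← hz]; ring⟩

/-- Iterating `y = c + π z` produces the coefficients of a power series one at a time; the remainder
after `n` steps is divisible by `π^n`. -/
theorem evalPowerSeries_surjective (hπ : IsLocalRing.maximalIdeal A = Ideal.span {π})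
    (hres : ∀ a : A, ∃ c : k, a - algebraMap k A c ∈ IsLocalRing.maximalIdeal A)
    (hπm : π ∈ IsLocalRing.maximalIdeal A) :
    Function.Surjective (evalPowerSeries (k := k) hπm) := by
  intro y
  choose c z hz using AdicCompletion.exists_eq_add_of_mul (k := k) hπ hres
  have hsum : ∀ n, y = algebraMap A _ (Polynomial.aeval π
      (PowerSeries.trunc n (PowerSeries.mk fun i => c (z^[i] y)))) +
        algebraMap A _ (π ^ n) * z^[n] y := by
    intro n
    induction n with
    | zero => simp
    | succ n ih =>
      conv_lhs => rw [ih, hz (z^[n] y)]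
      rw [PowerSeries.trunc_succ, map_add, Polynomial.aeval_monomial, PowerSeries.coeff_mk,
        Function.iterate_succ_apply', map_add, map_mul, pow_succ, map_mul,
        IsScalarTower.algebraMap_apply k A (AdicCompletion _ A)]
      ring
  refine ⟨PowerSeries.mk fun i => c (z^[i] y), AdicCompletion.ext_evalₐ fun n => ?_⟩
  rw [evalₐ_evalPowerSeries, hsum n]
  rw [map_add, map_mul, AlgHom.commutes, AlgHom.commutes]
  have : algebraMap A (A ⧸ IsLocalRing.maximalIdeal A ^ n) (π ^ n) = 0 :=
    Ideal.Quotient.eq_zero_iff_mem.2 (Ideal.pow_mem_pow hπm n)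
  rw [this, zero_mul, add_zero, ← hsum n]
  rfl

/-- The completion of a local domain with principal maximal ideal and with residue field `k`. -/
theorem AdicCompletion.nonempty_algEquiv_powerSeries [IsDomain A]
    (hπ : IsLocalRing.maximalIdeal A = Ideal.span {π}) (hπ0 : π ≠ 0)
    (hres : ∀ a : A, ∃ c : k, a - algebraMap k A c ∈ IsLocalRing.maximalIdeal A) :
    Nonempty (AdicCompletion (IsLocalRing.maximalIdeal A) A ≃ₐ[k] k⟦X⟧) := by
  have hπm : π ∈ IsLocalRing.maximalIdeal A := hπ ▸ Ideal.mem_span_singleton_self π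
  exact ⟨(AlgEquiv.ofBijective (evalPowerSeries hπm) ⟨evalPowerSeries_injective hπ hπ0 hπm,
    evalPowerSeries_surjective hπ hres hπm⟩).symm⟩

/-- A uniformizer of `A` becomes a uniformizer of `k[[t]]`. -/
theorem AdicCompletion.span_algEquiv_eq (hπ : IsLocalRing.maximalIdeal A = Ideal.span {π})
    (e : AdicCompletion (IsLocalRing.maximalIdeal A) A ≃ₐ[k] k⟦X⟧) :
    Ideal.span {e (algebraMap A _ π)} = Ideal.span {PowerSeries.X} := by
  have hfg : (IsLocalRing.maximalIdeal A).FG := ⟨{π}, by rw [hπ, Finset.coe_singleton]⟩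
  have hmax : (RingHom.ker (AdicCompletion.evalOneₐ
      (IsLocalRing.maximalIdeal A)).toRingHom).IsMaximal := by
    let _ : Field (A ⧸ IsLocalRing.maximalIdeal A) := Ideal.Quotient.field _
    exact RingHom.ker_isMaximal_of_surjective _ (AdicCompletion.evalOneₐ_surjective _)
  rw [AdicCompletion.ker_evalOneₐ_eq_map _ hfg, Ideal.map_eq_span_of_maximal hπ] at hmax
  have h2 := Ideal.map_isMaximal_of_equiv e.toRingEquiv (hp := hmax)
  rw [Ideal.map_span, Set.image_singleton] at h2
  rw [← PowerSeries.maximalIdeal_eq_span_X]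
  exact IsLocalRing.eq_maximalIdeal h2

end Completion


/-! ### Regularity of smooth local rings of dimension one -/

section SmoothLocalRing

variable {k : Type u} [Field k] {A : Type w} [CommRing A] [IsLocalRing A] [Algebra k A]

open IsLocalRing in
/-- The derivation `a ↦ [a - a(x)]` of a local `k`-algebra with residue field `k` into its
cotangent space. -/
theorem exists_derivation_cotangentSpace
    (hres : ∀ a : A, ∃ c : k, a - algebraMap k A c ∈ maximalIdeal A) :
    ∃ D : Derivation k A (maximalIdeal A).Cotangent,
      ∀ a : maximalIdeal A, D a = (maximalIdeal A).toCotangent a := by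
  choose ε hε using hres
  have huniq : ∀ (a : A) (c : k), a - algebraMap k A c ∈ maximalIdeal A → ε a = c := by
    intro a c hc
    by_contra hne
    have h := sub_mem (hε a) hc
    rw [sub_sub_sub_cancel_left, ← map_sub] at h
    exact (mem_maximalIdeal _).1 h ((sub_ne_zero.2 (Ne.symm hne)).isUnit.map (algebraMap k A))
  let φ : A →ₗ[k] maximalIdeal A :=
    { toFun := fun a => ⟨a - algebraMap k A (ε a), hε a⟩
      map_add' := fun a b => by
        have h : ε (a + b) = ε a + ε b := huniq _ _ <| by
          rw [map_add, add_sub_add_comm]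
          exact add_mem (hε a) (hε b)
        ext
        simp [h, add_sub_add_comm]
      map_smul' := fun c a => by
        have h : ε (c • a) = c * ε a := huniq _ _ <| by
          rw [map_mul, Algebra.smul_def, ← mul_sub]
          exact Ideal.mul_mem_left _ _ (hε a)
        ext
        change c • a - algebraMap k A (ε (c • a)) = c • (a - algebraMap k A (ε a))
        rw [h, smul_sub, map_mul, Algebra.smul_def c (algebraMap k A (ε a))] }
  refine ⟨Derivation.mk' (((maximalIdeal A).toCotangent.restrictScalars k) ∘ₗ φ) fun a b => ?_, ?_⟩
  · have h : ε (a * b) = ε a * ε b := huniq _ _ <| by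
      have := add_mem (Ideal.mul_mem_right b _ (hε a))
        (Ideal.mul_mem_left _ (algebraMap k A (ε a)) (hε b))
      convert this using 1
      rw [map_mul]
      ring
    change (maximalIdeal A).toCotangent (φ (a * b)) = a • (maximalIdeal A).toCotangent (φ b) +
      b • (maximalIdeal A).toCotangent (φ a)
    rw [← (maximalIdeal A).toCotangent.map_smul, ← (maximalIdeal A).toCotangent.map_smul, ← map_add,
      Ideal.toCotangent_eq]
    -- The Leibniz rule fails only by the product `(a - a(x)) (b - b(x))`, which lies in the square
    -- of the maximal ideal.
    have h2 := neg_mem (Ideal.mul_mem_mul (hε a) (hε b))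
    rw [pow_two]
    convert h2 using 1
    simp [φ, h]
    ring
  · intro a
    change (maximalIdeal A).toCotangent (φ a) = _
    congr 1
    ext
    have h : ε a = 0 := huniq _ _ (by simp)
    simp [φ, h]

/-- The derivation into the cotangent space factors through `Ω`, so the image of `ω` generates the
cotangent space. Nakayama's lemma lifts this to a generator of the maximal ideal. -/
theorem IsLocalRing.exists_maximalIdeal_eq_span [IsNoetherianRing A]
    (hres : ∀ a : A, ∃ c : k, a - algebraMap k A c ∈ maximalIdeal A)
    {ω : Ω[A⁄k]} (hω : Submodule.span A {ω} = ⊤) :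
    ∃ π : A, maximalIdeal A = Ideal.span {π} := by
  obtain ⟨D, hD⟩ := exists_derivation_cotangentSpace hres
  obtain ⟨π, hπ⟩ := (maximalIdeal A).toCotangent_surjective (D.liftKaehlerDifferential ω)
  refine ⟨π, le_antisymm ?_ ((Ideal.span_singleton_le_iff_mem _).2 π.2)⟩
  refine Submodule.le_of_le_smul_of_le_jacobson_bot (I := maximalIdeal A)
    (IsNoetherian.noetherian _) (jacobson_eq_maximalIdeal ⊥ bot_ne_top).ge fun a ha => ?_
  obtain ⟨c, hc⟩ := Submodule.mem_span_singleton.1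
    (show KaehlerDifferential.D k A a ∈ Submodule.span A {ω} by rw [hω]; trivial)
  have h : (maximalIdeal A).toCotangent ⟨a, ha⟩ = (maximalIdeal A).toCotangent (c • π) := by
    rw [map_smul, hπ, ← map_smul, hc, Derivation.liftKaehlerDifferential_comp_D, ← hD]
  rw [Ideal.toCotangent_eq, pow_two] at h
  refine Submodule.mem_sup.2 ⟨c * π, Ideal.mul_mem_left _ _ (Ideal.mem_span_singleton_self _),
    _, h, by simp⟩

theorem IsLocalRing.exists_maximalIdeal_eq_span_of_isLocalization [IsDomain A] [IsNoetherianRing A]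
    (hres : ∀ a : A, ∃ c : k, a - algebraMap k A c ∈ maximalIdeal A)
    {B : Type w'} [CommRing B] [Algebra k B] [Algebra B A] [IsScalarTower k B A] (M : Submonoid B)
    [IsLocalization M A] (hinj : Function.Injective (algebraMap B A))
    [Module.Free B Ω[B⁄k]] (hrank : Module.rank B Ω[B⁄k] = 1) :
    ∃ π : A, maximalIdeal A = Ideal.span {π} ∧ π ≠ 0 := by
  have : Nontrivial B := (algebraMap B A).domain_nontrivial
  have := Module.finite_of_rank_eq_one hrank
  obtain ⟨b⟩ : Nonempty (Module.Basis (Fin 1) B Ω[B⁄k]) :=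
    ⟨Module.finBasisOfFinrankEq _ _ (Module.rank_eq_one_iff_finrank_eq_one.1 hrank)⟩
  have hω : Submodule.span A {KaehlerDifferential.map k k B A (b 0)} = ⊤ := by
    have h := span_eq_top_of_isLocalizedModule A M (KaehlerDifferential.map k k B A) b.span_eq
    rw [← h, Set.range_unique]
    simp
  obtain ⟨π, hπ⟩ := exists_maximalIdeal_eq_span hres hω
  refine ⟨π, hπ, ?_⟩
  rintro rfl
  -- If `π = 0` then `A`, and with it `B`, consists of constants, so `Ω[B⁄k] = 0`, against rank one.
  have hsurj : Function.Surjective (algebraMap k B) := by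
    intro x
    obtain ⟨c, hc⟩ := hres (algebraMap B A x)
    refine ⟨c, hinj ?_⟩
    rw [hπ, Ideal.span_singleton_eq_bot.2 rfl, Ideal.mem_bot, sub_eq_zero] at hc
    rw [hc, ← IsScalarTower.algebraMap_apply]
  have := KaehlerDifferential.subsingleton_of_surjective k B hsurj
  exact b.ne_zero 0 (Subsingleton.elim _ _)

end SmoothLocalRing


/-! ### Local rings of a smooth curve at closed points -/

section CurveLocal

variable {k : Type u} [Field k] {X : Scheme.{u}} (f : X ⟶ Spec (CommRingCat.of k)) (x : X)

/-- The structure morphism of the `k`-algebra `LocalRingAt f x`. -/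
noncomputable def stalkStructure : CommRingCat.of k ⟶ X.presheaf.stalk x :=
  (Scheme.ΓSpecIso (CommRingCat.of k)).inv ≫ f.appTop ≫ X.presheaf.germ ⊤ x trivial

theorem SpecMap_stalkStructure : Spec.map (stalkStructure f x) = X.fromSpecStalk x ≫ f := by
  rw [stalkStructure, Spec.map_comp, Spec.map_comp, ← Scheme.fromSpecStalk_toSpecΓ, Category.assoc,
    Category.assoc, ← Scheme.toSpecΓ_naturality_assoc, ← SpecMap_ΓSpecIso_hom, ← Spec.map_comp,
    Iso.inv_hom_id, Spec.map_id, Category.comp_id]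

/-- By the Nullstellensatz the residue field at a closed point is `k`; the work lies in matching
this identification with the algebra structure on the stalk. -/
theorem LocalRingAt.exists_sub_mem [IsAlgClosed k] [LocallyOfFiniteType f]
    (hx : IsClosed ({x} : Set X)) (a : LocalRingAt f x) :
    ∃ c : k, a - algebraMap k _ c ∈ IsLocalRing.maximalIdeal (LocalRingAt f x) := by
  have h : (residueFieldIsoBase f x hx).inv = stalkStructure f x ≫ X.residue x := by
    apply Spec.map_injective
    rw [SpecMap_residueFieldIsoBase_inv, Spec.map_comp, SpecMap_stalkStructure,
      Scheme.fromSpecResidueField, Category.assoc]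
  refine ⟨(residueFieldIsoBase f x hx).hom (X.residue x a), ?_⟩
  rw [← IsLocalRing.residue_eq_zero_iff, map_sub, sub_eq_zero]
  have h2 := congr(($h) ((residueFieldIsoBase f x hx).hom (X.residue x a)))
  rw [← CommRingCat.comp_apply, Iso.hom_inv_id, CommRingCat.id_apply, CommRingCat.comp_apply] at h2
  exact h2

instance [IsIntegral X] : IsDomain (LocalRingAt f x) :=
  inferInstanceAs (IsDomain (X.presheaf.stalk x))

instance [IsLocallyNoetherian X] : IsNoetherianRing (LocalRingAt f x) :=
  inferInstanceAs (IsNoetherianRing (X.presheaf.stalk x))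

theorem LocalRingAt.exists_maximalIdeal_eq_span [IsAlgClosed k] [IsIntegral X]
    [SmoothOfRelativeDimension 1 f] (hx : IsClosed ({x} : Set X)) :
    ∃ π : LocalRingAt f x, IsLocalRing.maximalIdeal (LocalRingAt f x) = Ideal.span {π} ∧ π ≠ 0 := by
  have := SmoothOfRelativeDimension.smooth 1 f
  have := LocallyOfFiniteType.isLocallyNoetherian f
  obtain ⟨U, hU, V, hV, hxV, e, hf⟩ :=
    SmoothOfRelativeDimension.exists_isStandardSmoothOfRelativeDimension (n := 1) (f := f) x
  -- `Spec k` has a single point, so the chart on the base is everything.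
  have hUtop : U = ⊤ := by
    ext y
    have : y = f x := Subsingleton.elim (α := PrimeSpectrum k) _ _
    simpa [this] using e hxV
  subst hUtop
  have hf' : ((Scheme.ΓSpecIso (CommRingCat.of k)).inv ≫
      f.appLE ⊤ V e).hom.IsStandardSmoothOfRelativeDimension 1 :=
    RingHom.isStandardSmoothOfRelativeDimension_respectsIso.2 _
      (Scheme.ΓSpecIso (CommRingCat.of k)).symm.commRingCatIsoToRingEquiv hf
  algebraize [((Scheme.ΓSpecIso (CommRingCat.of k)).inv ≫ f.appLE ⊤ V e).hom]
  have := hf'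
  let := X.presheaf.algebra_section_stalk ⟨x, hxV⟩
  have hloc := hV.isLocalization_stalk ⟨x, hxV⟩
  let : Algebra Γ(X, V) (LocalRingAt f x) := X.presheaf.algebra_section_stalk ⟨x, hxV⟩
  have : IsScalarTower k Γ(X, V) (LocalRingAt f x) := .of_algebraMap_eq fun c => by
    change stalkStructure f x c = X.presheaf.germ V x hxV
      (f.appLE ⊤ V e ((Scheme.ΓSpecIso (CommRingCat.of k)).inv c))
    have h : (Scheme.ΓSpecIso (CommRingCat.of k)).inv ≫ f.appLE ⊤ V e ≫ X.presheaf.germ V x hxV =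
        stalkStructure f x := by
      rw [stalkStructure, Scheme.Hom.appLE, Category.assoc]
      congr 2
      exact X.presheaf.germ_res _ _ _
    rw [← h]
    rfl
  have hinj : Function.Injective (algebraMap Γ(X, V) (LocalRingAt f x)) :=
    germ_injective_of_isIntegral X x hxV
  have : Nontrivial Γ(X, V) := (algebraMap Γ(X, V) (LocalRingAt f x)).domain_nontrivial
  have : IsLocalization (hV.primeIdealOf ⟨x, hxV⟩).asIdeal.primeCompl (LocalRingAt f x) := hloc
  have : Algebra.IsStandardSmooth k Γ(X, V) :=
    Algebra.IsStandardSmoothOfRelativeDimension.isStandardSmooth 1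
  exact IsLocalRing.exists_maximalIdeal_eq_span_of_isLocalization
    (LocalRingAt.exists_sub_mem f x hx) (hV.primeIdealOf ⟨x, hxV⟩).asIdeal.primeCompl hinj
    (by simpa using Algebra.IsStandardSmoothOfRelativeDimension.rank_kaehlerDifferential (R := k) 1)

theorem LocalRingAt.isDiscreteValuationRing [IsAlgClosed k] [IsIntegral X]
    [SmoothOfRelativeDimension 1 f] (hx : IsClosed ({x} : Set X)) :
    IsDiscreteValuationRing (LocalRingAt f x) := by
  have := SmoothOfRelativeDimension.smooth 1 f
  have := LocallyOfFiniteType.isLocallyNoetherian f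
  obtain ⟨π, hπ, hπ0⟩ := LocalRingAt.exists_maximalIdeal_eq_span f x hx
  refine ((IsDiscreteValuationRing.TFAE (LocalRingAt f x) fun h => ?_).out 0 4).2
    (show (IsLocalRing.maximalIdeal (LocalRingAt f x)).IsPrincipal from ⟨π, hπ⟩)
  rw [IsLocalRing.isField_iff_maximalIdeal_eq, hπ, Ideal.span_singleton_eq_bot] at h
  exact hπ0 h

instance [IsIntegral X] : IsFractionRing (LocalRingAt f x) (RatFunctions f) :=
  inferInstanceAs (IsFractionRing (X.presheaf.stalk x) X.functionField)

instance [IsIntegral X] : IsScalarTower k (LocalRingAt f x) (RatFunctions f) :=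
  .of_algebraMap_eq fun c => by
    have h : stalkStructure f x ≫
        X.presheaf.stalkSpecializes ((genericPoint_spec X).specializes trivial) =
        stalkStructure f (genericPoint X) := by
      rw [stalkStructure, Category.assoc, Category.assoc]
      exact congr(_ ≫ _ ≫ $(X.presheaf.germ_stalkSpecializes (U := ⊤) _ _))
    exact congr($h c).symm

theorem nonempty_formalCoordinate [IsAlgClosed k] [IsIntegral X]
    [SmoothOfRelativeDimension 1 f] (hx : IsClosed ({x} : Set X)) :
    Nonempty (FormalCoordinate f x) := by
  have := SmoothOfRelativeDimension.smooth 1 f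
  have := LocallyOfFiniteType.isLocallyNoetherian f
  obtain ⟨π, hπ, hπ0⟩ := LocalRingAt.exists_maximalIdeal_eq_span f x hx
  obtain ⟨e⟩ := AdicCompletion.nonempty_algEquiv_powerSeries (k := k) hπ hπ0
    (LocalRingAt.exists_sub_mem f x hx)
  let ρ : LocalRingAt f x →ₐ[k] k⸨X⸩ := (coeAlgHom k).comp (e.toAlgHom.comp
    (IsScalarTower.toAlgHom k (LocalRingAt f x)
      (AdicCompletion (IsLocalRing.maximalIdeal (LocalRingAt f x)) (LocalRingAt f x))))
  have hρ : Function.Injective ρ := by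
    refine coeAlgHom_injective.comp (e.injective.comp ?_)
    exact AdicCompletion.of_injective _ _
  exact ⟨⟨e, IsFractionRing.liftAlgHom hρ, fun s =>
    IsFractionRing.lift_algebraMap (g := ρ.toRingHom) hρ s⟩⟩

end CurveLocal


/-! ### Weak approximation on curves -/

section LaurentAbs

variable (k : Type u) [Field k]

open Classical in
/-- The `t`-adic absolute value `f ↦ 2 ^ (- ord f)` of `k((t))`. -/
noncomputable def laurentAbs : AbsoluteValue k⸨X⸩ ℝ where
  toFun f := if f = 0 then 0 else 2 ^ (-f.order)
  map_mul' f g := by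
    rcases eq_or_ne f 0 with rfl | hf
    · simp
    rcases eq_or_ne g 0 with rfl | hg
    · simp
    rw [if_neg hf, if_neg hg, if_neg (mul_ne_zero hf hg), HahnSeries.order_mul hf hg, neg_add,
      zpow_add₀ two_ne_zero]
  nonneg' f := by positivity
  eq_zero' f := by
    split_ifs with h
    · simpa
    · simpa [h] using (zpow_pos two_pos _).ne'
  add_le' f g := by
    rcases eq_or_ne f 0 with rfl | hf
    · simp
    rcases eq_or_ne g 0 with rfl | hg
    · simp
    rw [if_neg hf, if_neg hg]
    have hf' : (0 : ℝ) < 2 ^ (-f.order) := zpow_pos two_pos _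
    have hg' : (0 : ℝ) < 2 ^ (-g.order) := zpow_pos two_pos _
    split_ifs with h
    · positivity
    rcases min_le_iff.1 (HahnSeries.min_order_le_order_add h) with h' | h'
    · exact (zpow_le_zpow_right₀ one_le_two (neg_le_neg h')).trans (le_add_of_nonneg_right hg'.le)
    · exact (zpow_le_zpow_right₀ one_le_two (neg_le_neg h')).trans (le_add_of_nonneg_left hf'.le)

variable {k}

theorem laurentAbs_le_iff {f : k⸨X⸩} {n : ℤ} : laurentAbs k f ≤ 2 ^ (-n) ↔ f ∈ tFil k n := by
  classical
  change (if f = 0 then 0 else (2 : ℝ) ^ (-f.order)) ≤ _ ↔ _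
  split_ifs with h
  · subst h
    simpa using (zpow_pos two_pos n).le
  · rw [zpow_le_zpow_iff_right₀ one_lt_two, neg_le_neg_iff, mem_tFil_iff_le_orderTop,
      ← HahnSeries.order_eq_orderTop_of_ne_zero h, WithTop.coe_le_coe]

end LaurentAbs

/-! ### Expansion of rational functions at one closed point. -/

namespace FormalCoordinate

variable {k : Type u} [Field k] {X : Scheme.{u}} {f : X ⟶ Spec (CommRingCat.of k)} {x : X}
  [IsIntegral X]

/-- The expansion of germs of regular functions in power series. -/
noncomputable def expandReg (τ : FormalCoordinate f x) : LocalRingAt f x →ₐ[k] k⟦X⟧ :=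
  τ.iso.toAlgHom.comp (IsScalarTower.toAlgHom k (LocalRingAt f x)
    (AdicCompletion (IsLocalRing.maximalIdeal (LocalRingAt f x)) (LocalRingAt f x)))

theorem expand_algebraMap_eq (τ : FormalCoordinate f x) (a : LocalRingAt f x) :
    τ.expand (algebraMap _ _ a) = (τ.expandReg a : k⸨X⸩) := τ.expand_algebraMap a

variable (τ : FormalCoordinate f x) {π : LocalRingAt f x}

theorem exists_X_eq_mul (hπ : IsLocalRing.maximalIdeal (LocalRingAt f x) = Ideal.span {π}) :
    ∃ u : k⟦X⟧, PowerSeries.X = τ.expandReg π * u :=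
  Ideal.span_singleton_le_span_singleton.1 (AdicCompletion.span_algEquiv_eq hπ τ.iso).ge

theorem X_dvd_expandReg (hπ : IsLocalRing.maximalIdeal (LocalRingAt f x) = Ideal.span {π}) :
    PowerSeries.X ∣ τ.expandReg π :=
  Ideal.span_singleton_le_span_singleton.1 (AdicCompletion.span_algEquiv_eq hπ τ.iso).le

theorem exists_pow_dvd_expandReg_sub
    (hπ : IsLocalRing.maximalIdeal (LocalRingAt f x) = Ideal.span {π}) (n : ℕ) (p : k⟦X⟧) :
    ∃ a, PowerSeries.X ^ n ∣ τ.expandReg a - p := by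
  induction n generalizing p with
  | zero => exact ⟨0, by simp⟩
  | succ n ih =>
    obtain ⟨u, hu⟩ := τ.exists_X_eq_mul hπ
    obtain ⟨q, hq⟩ : PowerSeries.X ∣ p - PowerSeries.C (PowerSeries.constantCoeff p) := by
      simp [PowerSeries.X_dvd_iff]
    obtain ⟨a, ha⟩ := ih (u * q)
    refine ⟨algebraMap k _ (PowerSeries.constantCoeff p) + π * a, ?_⟩
    have h : τ.expandReg (algebraMap k _ (PowerSeries.constantCoeff p) + π * a) - p =
        τ.expandReg π * (τ.expandReg a - u * q) := by
      rw [map_add, AlgHom.commutes, map_mul, mul_sub, ← mul_assoc, ← hu, ← hq]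
      change PowerSeries.C _ + _ - _ = _
      ring
    rw [h, pow_succ']
    exact mul_dvd_mul (τ.X_dvd_expandReg hπ) ha

/-- Density of `k(X)` in its completion at one point: multiply `g` by a power `π^r` that makes it
integral, approximate to order `n + r` by a germ, and divide by `π^r`. -/
theorem exists_expand_sub_mem_tFil
    (hπ : IsLocalRing.maximalIdeal (LocalRingAt f x) = Ideal.span {π}) (g : k⸨X⸩) (n : ℕ) :
    ∃ s, τ.expand s - g ∈ tFil k n := by
  obtain ⟨u, hu⟩ := τ.exists_X_eq_mul hπ
  obtain ⟨v, hv⟩ := τ.X_dvd_expandReg hπ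
  obtain ⟨m, hm⟩ := exists_mem_tFil g
  set r := m.natAbs
  have hX : ((PowerSeries.X : k⟦X⟧) : k⸨X⸩) = HahnSeries.single 1 1 := by simp
  have hπ0 : (τ.expandReg π : k⸨X⸩) ≠ 0 := by
    intro h0
    have := congrArg (fun p : k⟦X⟧ => (p : k⸨X⸩)) hu
    simp [h0] at this
  have hpow : ((τ.expandReg π) : k⸨X⸩) ^ r ∈ tFil k r := by
    rw [← PowerSeries.coe_pow, coe_mem_tFil_iff, hv, mul_pow]
    exact dvd_mul_right _ _
  have hinv : ((τ.expandReg π : k⸨X⸩)⁻¹) ^ r ∈ tFil k (-r) := by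
    have h1 : (τ.expandReg π : k⸨X⸩)⁻¹ = HahnSeries.single (-1) 1 * (u : k⸨X⸩) := by
      refine inv_eq_of_mul_eq_one_right ?_
      rw [mul_left_comm, ← PowerSeries.coe_mul, ← hu, hX, HahnSeries.single_mul_single]
      simp
    rw [h1, mul_pow, ← PowerSeries.coe_pow]
    refine mul_mem_tFil (m := -r) (n := 0) ?_ (coe_mem_tFil _) (by omega)
    rw [HahnSeries.single_pow]
    intro i hi
    exact HahnSeries.coeff_single_of_ne (by simp; omega)
  obtain ⟨p, hp⟩ := exists_coe_eq (mul_mem_tFil hpow hm (l := 0) (by omega))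
  obtain ⟨a, ha⟩ := τ.exists_pow_dvd_expandReg_sub hπ (n + r) p
  refine ⟨algebraMap _ _ a * (algebraMap _ _ π)⁻¹ ^ r, ?_⟩
  have h2 : τ.expand (algebraMap _ _ a * (algebraMap _ _ π)⁻¹ ^ r) - g =
      ((τ.expandReg a - p : k⟦X⟧) : k⸨X⸩) * ((τ.expandReg π : k⸨X⸩)⁻¹) ^ r := by
    rw [map_mul, map_pow, map_inv₀, expand_algebraMap_eq, expand_algebraMap_eq,
      PowerSeries.coe_sub, hp, sub_mul, mul_right_comm, ← mul_pow, mul_inv_cancel₀ hπ0, one_pow,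
      one_mul]
  rw [h2]
  exact mul_mem_tFil (coe_mem_tFil_iff.2 ha) hinv (by push_cast; omega)

theorem expand_mem_tFil_zero_iff [IsAlgClosed k] [SmoothOfRelativeDimension 1 f]
    (hx : IsClosed ({x} : Set X)) {s : RatFunctions f} :
    τ.expand s ∈ tFil k 0 ↔ s ∈ (algebraMap (LocalRingAt f x) (RatFunctions f)).range := by
  have := LocalRingAt.isDiscreteValuationRing f x hx
  obtain ⟨π, hπ, -⟩ := LocalRingAt.exists_maximalIdeal_eq_span f x hx
  constructor
  · intro h
    obtain ⟨a, rfl⟩ | ⟨a, ha⟩ := ValuationRing.isInteger_or_isInteger (LocalRingAt f x) s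
    · exact ⟨a, rfl⟩
    rcases eq_or_ne s 0 with rfl | hs
    · exact zero_mem _
    obtain ⟨p, hp⟩ := exists_coe_eq h
    have h1 : τ.expandReg a * p = 1 := by
      apply coeAlgHom_injective (k := k)
      rw [map_mul, map_one]
      change (τ.expandReg a : k⸨X⸩) * (p : k⸨X⸩) = 1
      rw [hp, ← expand_algebraMap_eq, ← map_mul, ha, inv_mul_cancel₀ hs, map_one]
    have hu : IsUnit a := by
      by_contra hna
      rw [← mem_nonunits_iff, ← IsLocalRing.mem_maximalIdeal, hπ, Ideal.mem_span_singleton] at hna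
      have h2 := (τ.X_dvd_expandReg hπ).trans (map_dvd τ.expandReg hna)
      exact PowerSeries.X_prime.not_isUnit (isUnit_of_dvd_one (h2.trans (h1 ▸ dvd_mul_right _ _)))
    obtain ⟨b, hb⟩ := hu.exists_right_inv
    refine ⟨b, ?_⟩
    have h3 := congrArg (algebraMap (LocalRingAt f x) (RatFunctions f)) hb
    rw [map_mul, map_one, ha] at h3
    exact (eq_of_inv_mul_eq_one h3).symm
  · rintro ⟨a, rfl⟩
    rw [expand_algebraMap_eq]
    exact coe_mem_tFil _

end FormalCoordinate


/-! ### Distinct points have distinct local rings -/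

section Separated

variable {k : Type u} [Field k] {X : Scheme.{u}} [IsIntegral X]

/-- Equal local rings give two morphisms from the spectrum of the local ring at `y` to `X` over `k`
that agree at the generic point. Separatedness forces them to coincide, and comparing images of the
closed point gives `x = y`. -/
theorem stalk_range_injective (f : X ⟶ Spec (CommRingCat.of k)) [IsSeparated f] {x y : X}
    (h : (algebraMap (LocalRingAt f x) (RatFunctions f)).range =
      (algebraMap (LocalRingAt f y) (RatFunctions f)).range) : x = y := by
  have hx := IsFractionRing.injective (LocalRingAt f x) (RatFunctions f)
  have hy := IsFractionRing.injective (LocalRingAt f y) (RatFunctions f)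
  let e : LocalRingAt f x ≃+* LocalRingAt f y :=
    (RingEquiv.ofLeftInverse (Function.leftInverse_invFun hx)).trans
      ((RingEquiv.subringCongr h).trans
        (RingEquiv.ofLeftInverse (Function.leftInverse_invFun hy)).symm)
  have he : ∀ a, algebraMap _ (RatFunctions f) (e a) = algebraMap _ (RatFunctions f) a := by
    intro a
    have h1 := RingEquiv.apply_symm_apply
      (RingEquiv.ofLeftInverse (Function.leftInverse_invFun hy))
      (RingEquiv.subringCongr h (RingEquiv.ofLeftInverse (Function.leftInverse_invFun hx) a))
    exact congrArg Subtype.val h1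
  let φ : X.presheaf.stalk x ⟶ X.presheaf.stalk y := CommRingCat.ofHom e.toRingHom
  have hφ : stalkStructure f x ≫ φ = stalkStructure f y := by
    ext c
    apply hy
    change algebraMap _ (RatFunctions f) (e (algebraMap k _ c)) =
      algebraMap _ (RatFunctions f) (algebraMap k (LocalRingAt f y) c)
    rw [he, ← IsScalarTower.algebraMap_apply, ← IsScalarTower.algebraMap_apply]
  let sp (z : X) : X.presheaf.stalk z ⟶ X.functionField :=
    X.presheaf.stalkSpecializes ((genericPoint_spec X).specializes trivial)
  have hsp : φ ≫ sp y = sp x := by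
    ext a
    exact he a
  have hdom : IsDominant (Spec.map (sp y)) := by
    refine ⟨(PrimeSpectrum.denseRange_comap_iff_ker_le_nilRadical (sp y).hom).2 ?_⟩
    exact ((RingHom.injective_iff_ker_eq_bot _).1 hy).le.trans bot_le
  have key : Spec.map φ ≫ X.fromSpecStalk x = X.fromSpecStalk y := by
    refine ext_of_isDominant_of_isSeparated f ?_ (Spec.map (sp y)) ?_
    · rw [Category.assoc, ← SpecMap_stalkStructure, ← SpecMap_stalkStructure, ← Spec.map_comp, hφ]
    · rw [← Spec.map_comp_assoc, hsp]
      exact (Scheme.SpecMap_stalkSpecializes_fromSpecStalk _).trans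
        (Scheme.SpecMap_stalkSpecializes_fromSpecStalk _).symm
  have hclosed : Spec.map φ (IsLocalRing.closedPoint (X.presheaf.stalk y)) =
      IsLocalRing.closedPoint (X.presheaf.stalk x) := by
    have : IsLocalHom φ.hom := ⟨fun a ha => (MulEquiv.isUnit_map e).1 ha⟩
    exact IsLocalRing.comap_closedPoint φ.hom
  have h2 := congr($key (IsLocalRing.closedPoint (X.presheaf.stalk y)))
  rwa [show (Spec.map φ ≫ X.fromSpecStalk x) (IsLocalRing.closedPoint (X.presheaf.stalk y)) =
    X.fromSpecStalk x (Spec.map φ (IsLocalRing.closedPoint (X.presheaf.stalk y))) from rfl, hclosed,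
    Scheme.fromSpecStalk_closedPoint, Scheme.fromSpecStalk_closedPoint] at h2

end Separated

/-! ### Weak approximation and global connections with prescribed local classes. -/

section GlobalConnections

variable {k : Type u} [Field k] {X : Scheme.{u}} [IsIntegral X]
  {f : X ⟶ Spec (CommRingCat.of k)}

/-- The absolute value of the function field at a closed point. -/
noncomputable def FormalCoordinate.abs {x : X} (τ : FormalCoordinate f x) :
    AbsoluteValue (RatFunctions f) ℝ :=
  (laurentAbs k).comp τ.expand.injective

theorem FormalCoordinate.abs_apply {x : X} (τ : FormalCoordinate f x) (s : RatFunctions f) :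
    τ.abs s = laurentAbs k (τ.expand s) := rfl

variable [IsAlgClosed k] [SmoothOfRelativeDimension 1 f]

theorem FormalCoordinate.abs_le_one_iff {x : X} (hx : IsClosed ({x} : Set X))
    (τ : FormalCoordinate f x) (s : RatFunctions f) :
    τ.abs s ≤ 1 ↔ s ∈ (algebraMap (LocalRingAt f x) (RatFunctions f)).range := by
  rw [← τ.expand_mem_tFil_zero_iff hx, ← laurentAbs_le_iff, neg_zero, zpow_zero, abs_apply]

theorem FormalCoordinate.exists_expand_mem_tFil_one {x : X} (hx : IsClosed ({x} : Set X))
    (τ : FormalCoordinate f x) : ∃ s ≠ 0, τ.expand s ∈ tFil k 1 := by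
  obtain ⟨π, hπ, hπ0⟩ := LocalRingAt.exists_maximalIdeal_eq_span f x hx
  refine ⟨algebraMap _ _ π, by simpa using hπ0, ?_⟩
  rw [expand_algebraMap_eq]
  exact coe_mem_tFil_iff.2 (by simpa using τ.X_dvd_expandReg hπ)

theorem FormalCoordinate.abs_isNontrivial {x : X} (hx : IsClosed ({x} : Set X))
    (τ : FormalCoordinate f x) : τ.abs.IsNontrivial := by
  obtain ⟨s, hs, hs1⟩ := τ.exists_expand_mem_tFil_one hx
  refine ⟨s, hs, fun h => ?_⟩
  rw [← laurentAbs_le_iff, ← abs_apply, h] at hs1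
  norm_num at hs1

/-- Equivalent absolute values have the same unit ball, which here is the local ring, so distinct
points give inequivalent ones and `k(X)` is dense in its product over the points. Density at each
single point passes from rational targets to targets in `k((t))`. -/
theorem exists_forall_expand_sub_mem_tFil [IsSeparated f] {ι : Type*} [Finite ι] {x : ι → X}
    (hinj : Function.Injective x) (hx : ∀ i, IsClosed ({x i} : Set X))
    (τ : ∀ i, FormalCoordinate f (x i)) (g : ι → k⸨X⸩) (n : ℕ) :
    ∃ s, ∀ i, (τ i).expand s - g i ∈ tFil k n := by
  have := Fintype.ofFinite ι
  have hdense := AbsoluteValue.denseRange_algebraMap_pi (v := fun i => (τ i).abs)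
    (fun i => (τ i).abs_isNontrivial (hx i)) fun i j hij h => hij <| hinj <| by
      refine stalk_range_injective f (Subring.ext fun s => ?_)
      rw [← (τ i).abs_le_one_iff (hx i), h.le_one_iff, (τ j).abs_le_one_iff (hx j)]
  have happrox : ∀ i, ∃ z, (τ i).expand z - g i ∈ tFil k n := fun i => by
    obtain ⟨π, hπ, -⟩ := LocalRingAt.exists_maximalIdeal_eq_span f (x i) (hx i)
    exact (τ i).exists_expand_sub_mem_tFil hπ (g i) n
  choose z hz using happrox
  obtain ⟨s, hs⟩ := Metric.denseRange_iff.1 hdense (fun i => WithAbs.toAbs _ (z i))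
    (2 ^ (-(n : ℤ))) (zpow_pos two_pos _)
  refine ⟨s, fun i => ?_⟩
  have h1 := ((dist_pi_lt_iff (zpow_pos two_pos _)).1 hs i).le
  have h2 : (τ i).abs (z i - s) ≤ 2 ^ (-(n : ℤ)) := by
    rw [dist_eq_norm] at h1
    exact h1
  rw [FormalCoordinate.abs_apply, laurentAbs_le_iff, map_sub] at h2
  simpa using sub_mem (hz i) h2

theorem exists_forall_gaugeEquiv_restrict [CharZero k] [IsSeparated f]
    {H : Type v} [CommRing H] [HopfAlgebra k H]
    [Module.Finite k (LieAlg k H)] [Algebra.FormallySmooth k H] {ι : Type*} [Finite ι] {x : ι → X}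
    (hinj : Function.Injective x) (hx : ∀ i, IsClosed ({x i} : Set X))
    (τ : ∀ i, FormalCoordinate f (x i)) (A : ι → Conn k H k⸨X⸩) :
    ∃ B : Conn k H Ω[RatFunctions f⁄k],
      ∀ i, GaugeEquiv (laurentD k) (B.restrict (τ i).expand) (A i) := by
  rcases isEmpty_or_nonempty ι with hι | ⟨⟨i₀⟩⟩
  · exact ⟨0, fun i => hι.elim i⟩
  have := Fintype.ofFinite ι
  obtain ⟨s, hs0, hs⟩ := (τ i₀).exists_expand_mem_tFil_one (hx i₀)
  -- If `ds` vanished at one point, `s` would be a constant, as expansions are injective; but `s` is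
  -- nonzero and vanishes at `x i₀`.
  have hu : ∀ i, laurentD k ((τ i).expand s) ≠ 0 := by
    intro i hi
    have h1 := eq_algebraMap_of_laurentD_eq_zero hi
    rw [← (τ i).expand.commutes] at h1
    have h2 := (τ i).expand.injective h1
    rw [h2, AlgHom.commutes] at hs
    have h3 := hs 0 one_pos
    change (HahnSeries.C _).coeff 0 = 0 at h3
    rw [HahnSeries.C_apply, HahnSeries.coeff_single_same] at h3
    rw [h3, map_zero] at h2
    exact hs0 h2
  choose n hn using fun i => exists_forall_sub_mem_tLattice_gaugeEquiv (A i)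
  obtain ⟨m, hm⟩ := exists_forall_mem_tFil fun i => laurentD k ((τ i).expand s)
  let N := Finset.univ.sup n
  -- The coordinates of `A i` are divided by `ds` before approximation. Multiplying back by `ds`
  -- loses at most `|m|` orders, which the precision `N + |m|` allows for.
  choose c hc using fun j => exists_forall_expand_sub_mem_tFil hinj hx τ
    (fun i => (A i).toLin (lieCoord k H j) / laurentD k ((τ i).expand s)) (N + m.natAbs)
  refine ⟨∑ j, Module.finBasis k (LieAlg k H) j ⊗ₜ[k] (c j • KaehlerDifferential.D k _ s),
    fun i => hn i _ (tLattice_antitone k H (Finset.le_sup (Finset.mem_univ i)) ?_)⟩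
  have hB : Conn.restrict (τ i).expand
      (∑ j, Module.finBasis k (LieAlg k H) j ⊗ₜ[k] (c j • KaehlerDifferential.D k _ s)) =
      tangentOf k H fun j => (τ i).expand (c j) * laurentD k ((τ i).expand s) := by
    rw [tangentOf, map_sum]
    refine Finset.sum_congr rfl fun j _ => ?_
    rw [Conn.restrict, LinearMap.lTensor_tmul, pullbackDifferential_smul_D]
  have hA : A i = tangentOf k H fun j => (A i).toLin (lieCoord k H j) :=
    Conn.toLin_injective (A i).isTangentAt_toLin.eq_tangentOf
  have hsub : Conn.restrict (τ i).expand
      (∑ j, Module.finBasis k (LieAlg k H) j ⊗ₜ[k] (c j • KaehlerDifferential.D k _ s)) - A i =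
      tangentOf k H fun j => (τ i).expand (c j) * laurentD k ((τ i).expand s) -
        (A i).toLin (lieCoord k H j) := by
    conv_lhs => rw [hB, hA]
    simp only [tangentOf, ← Finset.sum_sub_distrib, ← TensorProduct.tmul_sub]
  rw [mem_tLattice_iff, hsub]
  refine tangentOf_mem_linFil fun j => ?_
  have h := mul_mem_tFil (hc j i) (hm i) (l := N) (by rw [Nat.cast_add]; omega)
  rwa [sub_mul, div_mul_cancel₀ _ (hu i)] at h

end GlobalConnections

theorem mainTheorem10 {k : Type u} [Field k] [IsAlgClosed k] [CharZero k]
    {H : Type v} [CommRing H] [HopfAlgebra k H] (hG : IsConnectedReductive k H) :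
    (∀ A : Conn k H k⸨X⸩,
      @IsOpen _ (tAdicTopology k H) {A' : Conn k H k⸨X⸩ | GaugeEquiv (laurentD k) A' A}) ∧
    (∀ A : Conn k H k⸨X⸩, ∃ n : ℕ, ∀ A' : Conn k H k⸨X⸩,
      A' - A ∈ tLattice k H n → GaugeEquiv (laurentD k) A' A) ∧
    (∀ (C : Scheme.{u}) (f : C ⟶ Spec (CommRingCat.of k))
      [IsIntegral C] [IsProper f] [SmoothOfRelativeDimension 1 f],
      (∀ x : C, IsClosed ({x} : Set C) → Nonempty (FormalCoordinate f x)) ∧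
      ∀ (N : ℕ) (x : Fin N → C), Function.Injective x → (∀ i, IsClosed ({x i} : Set C)) →
        ∀ (τ : ∀ i, FormalCoordinate f (x i)) (A : Fin N → Conn k H k⸨X⸩),
          ∃ B : Conn k H Ω[RatFunctions f⁄k],
            ∀ i, GaugeEquiv (laurentD k) (B.restrict (τ i).expand) (A i)) := by
  have := hG.smooth
  have := LieAlg.finite (k := k) (H := H)
  exact ⟨isOpen_gaugeEquiv, exists_forall_sub_mem_tLattice_gaugeEquiv, fun C f _ _ _ =>
    ⟨fun x hx => nonempty_formalCoordinate f x hx, fun N x hinj hx τ A =>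
      exists_forall_gaugeEquiv_restrict hinj hx τ A⟩⟩
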